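/- Let $R\ge 3$ be a prime number. A $d$-bubble is a finite graph, each of whose vertices is incident to exactly one edge of each of $d$ colors (no loops). Let $\mathcal K_{R+1}$ be the complete graph on the vertices $[C]$ and $[n]$, $n\in\mathbb Z/R\mathbb Z$, with its standard edge-coloring by $i\in\mathbb Z/R\mathbb Z$: $[C][i]$ has color $i$, and $[n][n']$ ($n\ne n'$) has color $i$ if and only if $n+n'\equiv 2i \pmod R$. Consider the $\mathrm O(N)^R$ tensor model of a real rank-$R$ tensor $T$ with action $S=N^{R-1}\bigl(\frac12 T^2+N^{\frac14(R-1)(R-2)}\lambda\, I_{\mathcal K_{R+1}}(T)\bigr)$. Its vacuum Feynman graphs are the connected $(R+1)$-bubbles $\mathcal B$, with colors $0$ (the propagators) and $i\in\mathbb Z/R\mathbb Z$, such that deleting the edges of color $0$ leaves a disjoint union $\mathcal B^{(0)}$ of copies of $\mathcal K_{R+1}$. Such a graph with $v$ interaction bubbles, $p$ propagators and $F_{0i}$ faces of colors $0,i$ carries the power of $N$ equal to $-(R-1)p+\bigl((R-1)+\tfrac14(R-1)(R-2)\bigr)v+\sum_iF_{0i}$; it is of leading order if this power is maximal among all vacuum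 graphs. The degree of a $d$-bubble is half the sum of the genera of its jackets over all cyclic orderings $\sigma$ of the colors (cycles of length $d$), where the jacket of $\sigma$ is the ribbon graph in which the edges are ordered clockwise according to $\sigma$ at every vertex and all edges are twisted; the index of $\mathcal B$ is $\mathrm{ind}_0\mathcal B=\frac1{(R-2)!}\bigl(\deg\mathcal B-R\deg\mathcal B^{(0)}\bigr)$. Then, for a bubble $\mathcal B$ with colors $0$ and $i\in\mathbb Z/R\mathbb Z$, the following are equivalent: 1. $\mathcal B$ is a leading order vacuum graph; 2. $\mathcal B$ is a prime-complete generalized melon, i.e. a vacuum graph with $\mathrm{ind}_0\mathcal B=0$; 3. $\mathcal B$ is a vacuum graph and, for all $i\neq j$, the jacket of the 3-bubble $\mathcal B_{(0ij)}$, formed by the edges of colors $0,i,j$, has genus $0$; 4. $\mathcal B$ is a mirror melon of $\mathcal K_{R+1}$, i.e. it is obtained, up to color-preserving isomorphism, from the elementary mirror melon (two copies of $\mathcal K_{R+1}$, with equally labeled vertices joined by edges of color $0$) by an arbitrary number of generalized melonic insertions, each of which replaces an edge of color $0$ by the 2-point graph obtained by cutting open an edge of color $0$ of the elementary mirror melon.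 -/

import Mathlib

/-! ### Edge-colored graphs (bubbles) -/

/-- A bubble with color set `C` and vertex set `V`: a (multi)graph, edge-colored by `C`, such that
every vertex is incident to exactly one edge of each color and no edge is a loop. It is encoded by
the map `inv` that sends a color `c` and a vertex `v` to the other endpoint of the edge of color
`c` at `v`. When `C` has `d` elements this is a `d`-bubble. It need not be connected. -/
structure Bubble (C V : Type) where
  inv : C → V → V
  inv_inv : ∀ c v, inv c (inv c v) = v
  inv_ne : ∀ c v, inv c v ≠ v

/-- The number of classes of the equivalence relation generated by `r`, i.e. the number of
connected components of the graph on `α` whose edges are the pairs related by `r`. -/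
noncomputable def numClasses {α : Type} (r : α → α → Prop) : ℕ := Nat.card (Quot r)

namespace Bubble

variable {C D V V' W : Type}

/-- The subgraph formed by all the vertices and only the edges of the colors `f x`, `x : D`
(renamed `x`). -/
def keep (B : Bubble C V) (f : D → C) : Bubble D V where
  inv x := B.inv (f x)
  inv_inv x := B.inv_inv (f x)
  inv_ne x := B.inv_ne (f x)

/-- The number of connected components. -/
noncomputable def numComponents (B : Bubble C V) : ℕ :=
  numClasses fun v w : V => ∃ c, B.inv c v = w

/-- A bubble is connected if it has exactly one connected component (so it is not empty). -/
def Connected (B : Bubble C V) : Prop := B.numComponents = 1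

/-- The number of faces of colors `a` and `b`, i.e. of cycles with edges of alternating colors `a`
and `b`: the number of connected components of the graph with only these two colors. -/
noncomputable def numFaces (B : Bubble C V) (a b : C) : ℕ := (B.keep ![a, b]).numComponents

/-- Isomorphism of edge-colored graphs (each color is preserved). -/
def IsIso (B : Bubble C V) (B' : Bubble C V') : Prop :=
  ∃ e : V ≃ V', ∀ c v, e (B.inv c v) = B'.inv c (e v)

/-- The disjoint union of copies of a bubble, indexed by `I`. -/
def copies (I : Type) (B : Bubble C V) : Bubble C (I × V) where
  inv c p := (p.1, B.inv c p.2)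
  inv_inv c p := by simp [B.inv_inv]
  inv_ne c p h := B.inv_ne c p.2 (congrArg Prod.snd h)

end Bubble

/-! ### Ribbon graphs -/

/-- A ribbon graph without isolated vertices, on the set `H` of half-edges: `rot h` is the next
half-edge clockwise around the vertex of `h`, so that the vertices are the cycles of `rot`;
`edge h` is the other half of the edge containing `h`; `twisted` tells which edges have
signature `-`. -/
structure RibbonGraph (H : Type) where
  rot : Equiv.Perm H
  edge : H → H
  edge_edge : ∀ h, edge (edge h) = h
  edge_ne : ∀ h, edge h ≠ h
  twisted : H → Prop
  twisted_edge : ∀ h, twisted (edge h) ↔ twisted h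

namespace RibbonGraph

variable {H : Type}

noncomputable def numVertices (G : RibbonGraph H) : ℕ := numClasses fun h h' => G.rot h = h'

noncomputable def numEdges (G : RibbonGraph H) : ℕ := numClasses fun h h' => G.edge h = h'

noncomputable def numComponents (G : RibbonGraph H) : ℕ :=
  numClasses fun h h' => G.rot h = h' ∨ G.edge h = h'

/-- Adjacency of the sides of the half-edges along the border of the ribbon graph. The pair
`(h, true)` is the clockwise side of `h`, and `(h, false)` is its anticlockwise side. The
clockwise side of `h` meets the anticlockwise side of `rot h` at the vertex. Along an untwisted
ribbon the clockwise side of one half continues as the anticlockwise side of the other half;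
along a twisted one, clockwise continues as clockwise and anticlockwise as anticlockwise. -/
inductive Border (G : RibbonGraph H) : H × Bool → H × Bool → Prop
  | corner (h : H) : Border G (h, true) (G.rot h, false)
  | untwisted (h : H) (s : Bool) : ¬ G.twisted h → Border G (h, s) (G.edge h, !s)
  | twisted (h : H) (s : Bool) : G.twisted h → Border G (h, s) (G.edge h, s)

/-- The faces are the connected components of the border. -/
noncomputable def numFaces (G : RibbonGraph H) : ℕ := numClasses G.Border

/-- The genus, given by Euler's formula `2 c - 2 g = V - E + F` with `c` the number of connected
components. It is a half-integer in the non-orientable case, and for a disconnected graph it is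
the sum of the genera of the components. -/
noncomputable def genus (G : RibbonGraph H) : ℚ :=
  (G.numComponents : ℚ)
    - ((G.numVertices : ℚ) - (G.numEdges : ℚ) + (G.numFaces : ℚ)) / 2

end RibbonGraph

/-! ### Jackets, degree and index -/

namespace Bubble

variable {C V V' W : Type}

/-- The jacket of a bubble associated with a cyclic permutation `σ` of the colors and with a set
`filled` of vertices: the edges are ordered clockwise according to `σ` around the unfilled
vertices, anticlockwise around the filled ones, and an edge is twisted if and only if its two ends
are of the same type. -/
noncomputable def jacket (B : Bubble C V) (σ : Equiv.Perm C) (filled : Set V) :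
    RibbonGraph (V × C) where
  rot := open Classical in
    { toFun := fun p => (p.1, if p.1 ∈ filled then σ.symm p.2 else σ p.2)
      invFun := fun p => (p.1, if p.1 ∈ filled then σ p.2 else σ.symm p.2)
      left_inv := fun p => by by_cases h : p.1 ∈ filled <;> simp [h]
      right_inv := fun p => by by_cases h : p.1 ∈ filled <;> simp [h] }
  edge p := (B.inv p.2 p.1, p.2)
  edge_edge p := by simp [B.inv_inv]
  edge_ne p h := B.inv_ne p.2 p.1 (congrArg Prod.fst h)
  twisted p := p.1 ∈ filled ↔ B.inv p.2 p.1 ∈ filled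
  twisted_edge p := by simp only [B.inv_inv]; exact Iff.comm

/-- The genus of the jacket associated with `σ`. Changing the type of a vertex is a local switch of
the ribbon graph (reversal of the cyclic order at the vertex and flip of the signatures of the
incident edges), so the choice of the filled vertices is irrelevant; here no vertex is filled. -/
noncomputable def jacketGenus (B : Bubble C V) (σ : Equiv.Perm C) : ℚ := (B.jacket σ ∅).genus

open Classical in
/-- The degree of a `d`-bubble, `d ≥ 3`: half of the sum of the genera of its jackets over all the
permutations of the colors that are cycles of length `d`. -/
noncomputable def degree [Fintype C] (B : Bubble C V) : ℚ :=
  (1 / 2) * ∑ σ ∈ Finset.univ.filter (fun σ : Equiv.Perm C => σ.IsCycleOn Set.univ),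
    B.jacketGenus σ

/-- The 3-bubble with the edges of colors `a`, `b`, `c` is planar: its unique jacket has genus
zero. -/
def PlanarAt (B : Bubble C V) (a b c : C) : Prop :=
  (B.keep ![a, b, c]).jacketGenus (finRotate 3) = 0

/-! From now on the color set is `Option C`; the distinguished color `none` is the color `0` and
`some i`, `i : C`, are the other colors. -/

/-- The bubble obtained by deleting the edges of color `0`. -/
def deleteZero (B : Bubble (Option C) V) : Bubble C V := B.keep some

/-- The index of a `d`-bubble with respect to the color `0`, `d ≥ 4`:
`(deg B - (d - 1) deg B⁽⁰⁾) / (d - 3)!`, where `d - 1` is the number of elements of `C`. -/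
noncomputable def index [Fintype C] (B : Bubble (Option C) V) : ℚ :=
  (1 / ((Fintype.card C - 2).factorial : ℚ)) *
    (B.degree - (Fintype.card C : ℚ) * B.deleteZero.degree)

/-! ### Insertions and mirror melons -/

open Classical in
/-- Cut open the edge of color `0` joining `v` to `v₀` in `B` and the edge of color `0` joining `w`
to `w₀` in `B'`, and glue the open ends: `v` is joined to `w`, and `v₀` to `w₀`, by new edges of
color `0`. This is the insertion of the 2-point graph made from `B'` on an edge of `B`. (The
other way to glue is obtained by exchanging `w` and `w₀`.) -/
noncomputable def insertion (B : Bubble (Option C) V) (v : V) (B' : Bubble (Option C) W) (w : W) :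
    Bubble (Option C) (V ⊕ W) where
  inv
    | some i, Sum.inl x => Sum.inl (B.inv (some i) x)
    | some i, Sum.inr y => Sum.inr (B'.inv (some i) y)
    | none, Sum.inl x =>
        if x = v then Sum.inr w
        else if x = B.inv none v then Sum.inr (B'.inv none w)
        else Sum.inl (B.inv none x)
    | none, Sum.inr y =>
        if y = w then Sum.inl v
        else if y = B'.inv none w then Sum.inl (B.inv none v)
        else Sum.inr (B'.inv none y)
  inv_inv c z := by
    have h1 := B.inv_ne none v
    have h2 := B'.inv_ne none w
    have k1 : ∀ x, B.inv none x = v → x = B.inv none v := fun x h => by rw [← h, B.inv_inv]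
    have k2 : ∀ y, B'.inv none y = w → y = B'.inv none w := fun y h => by rw [← h, B'.inv_inv]
    have k3 : ∀ x, B.inv none x = B.inv none v → x = v := fun x h => by
      rw [← B.inv_inv none x, h, B.inv_inv]
    have k4 : ∀ y, B'.inv none y = B'.inv none w → y = w := fun y h => by
      rw [← B'.inv_inv none y, h, B'.inv_inv]
    rcases c with _ | i <;> rcases z with x | y
    · by_cases a : x = v
      · simp [a]
      · by_cases b : x = B.inv none v
        · simp [b, h1, h2]
        · have a' : ¬ B.inv none x = v := fun h => b (k1 x h)
          have b' : ¬ B.inv none x = B.inv none v := fun h => a (k3 x h)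
          simp [a, b, a', b', B.inv_inv]
    · by_cases a : y = w
      · simp [a]
      · by_cases b : y = B'.inv none w
        · simp [b, h1, h2]
        · have a' : ¬ B'.inv none y = w := fun h => b (k2 y h)
          have b' : ¬ B'.inv none y = B'.inv none w := fun h => a (k4 y h)
          simp [a, b, a', b', B'.inv_inv]
    · simp [B.inv_inv]
    · simp [B'.inv_inv]
  inv_ne c z := by
    rcases c with _ | i <;> rcases z with x | y
    · have := B.inv_ne none x
      by_cases a : x = v
      · simp [a]
      · by_cases b : x = B.inv none v <;> simp [a, b, this, B.inv_ne]
    · have := B'.inv_ne none y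
      by_cases a : y = w
      · simp [a]
      · by_cases b : y = B'.inv none w <;> simp [a, b, this, B'.inv_ne]
    · simp [B.inv_ne]
    · simp [B'.inv_ne]

/-- The elementary mirror melon of a bubble `B`: two copies of `B`, with each vertex of the first
joined by an edge of color `0` to the vertex with the same label in the second. -/
def elementaryMirrorMelon (B : Bubble C W) : Bubble (Option C) (Bool × W) where
  inv
    | none, p => (!p.1, p.2)
    | some i, p => (p.1, B.inv i p.2)
  inv_inv c p := by cases c <;> simp [B.inv_inv]
  inv_ne c p := by
    cases c
    · simp [Prod.ext_iff]
    · simp [Prod.ext_iff, B.inv_ne]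

/-- The mirror melons associated with `B`: the graphs obtained, up to isomorphism, from the
elementary mirror melon of `B` by an arbitrary number of insertions, on edges of color `0`, of the
2-point graphs obtained by cutting open an edge of color `0` of the elementary mirror melon. -/
inductive IsMirrorMelon (B : Bubble C W) : {V : Type} → Bubble (Option C) V → Prop
  | elementary : IsMirrorMelon B B.elementaryMirrorMelon
  | insertion {V : Type} (G : Bubble (Option C) V) (v : V) (w : Bool × W) :
      IsMirrorMelon B G → IsMirrorMelon B (G.insertion v B.elementaryMirrorMelon w)
  | iso {V V' : Type} (G : Bubble (Option C) V) (G' : Bubble (Option C) V') :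
      IsMirrorMelon B G → G.IsIso G' → IsMirrorMelon B G'

end Bubble

/-! ### The complete interaction -/

/-- In `ℤ/Rℤ` with `R` odd, doubling is injective. -/
theorem ZMod.eq_of_two_mul_sub {R : ℕ} (hR : Odd R) {i n : ZMod R} (h : 2 * i - n = n) :
    n = i := by
  have h2 : IsUnit ((2 : ℕ) : ZMod R) :=
    (ZMod.isUnit_iff_coprime 2 R).2 (Nat.coprime_two_left.2 hR)
  have : ((2 : ℕ) : ZMod R) * n = ((2 : ℕ) : ZMod R) * i := by
    push_cast; linear_combination -h
  exact h2.mul_left_cancel this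

/-- The complete bubble on `R + 1` vertices, `R` odd, with its standard coloring. The vertices are
the center `none` and the points `some n` of a regular `R`-gon, labeled by `ℤ/Rℤ`. The edge of
color `i` at the center goes to `some i`, and distinct polygon vertices `some n`, `some m` are
joined by an edge of color `i` if and only if `n + m = 2 i` in `ℤ/Rℤ`. -/
def completeBubble (R : ℕ) (hR : Odd R) : Bubble (ZMod R) (Option (ZMod R)) where
  inv i
    | none => some i
    | some n => if n = i then none else some (2 * i - n)
  inv_inv i v := by
    rcases v with _ | n
    · simp
    · by_cases h : n = i
      · simp [h]
      · have h' : ¬ 2 * i - n = i := fun e => h (by linear_combination -e)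
        simp [h, h']
  inv_ne i v := by
    rcases v with _ | n
    · simp
    · by_cases h : n = i
      · simp [h]
      · have h' : ¬ 2 * i - n = n := fun e => h (ZMod.eq_of_two_mul_sub hR e)
        simp [h, h']

/-- A (connected) vacuum Feynman graph of the model with the single interaction bubble
`completeBubble R`: a connected graph, with propagators as edges of color `0`, that becomes a
disjoint union of copies of the interaction bubble when the propagators are deleted. -/
def IsVacuumGraph {R : ℕ} (hR : Odd R) {V : Type} (G : Bubble (Option (ZMod R)) V) : Prop :=
  G.Connected ∧ ∃ n : ℕ, G.deleteZero.IsIso ((completeBubble R hR).copies (Fin n))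

/-- The power of `N` carried by a vacuum graph of the model with enhanced scaling, i.e. with action
`S = N^(R-1) (T² / 2 + N^((R-1)(R-2)/4) λ I(T))`, where `I` is the complete interaction: a factor
`N^(-(R-1))` for each propagator, a factor `N^((R-1) + (R-1)(R-2)/4)` for each interaction bubble
and a factor `N` for each index loop, i.e. each face of colors `0` and `i`, `i = 1, …, R`. -/
noncomputable def powerOfN {R : ℕ} [NeZero R] {V : Type} (G : Bubble (Option (ZMod R)) V) : ℚ :=
  - ((R : ℚ) - 1) * ((Nat.card V : ℚ) / 2)
    + (((R : ℚ) - 1) + ((R : ℚ) - 1) * ((R : ℚ) - 2) / 4) * (G.deleteZero.numComponents : ℚ)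
    + ∑ i : ZMod R, (G.numFaces none (some i) : ℚ)

/-- A leading order vacuum graph: one which carries the highest power of `N` among all the vacuum
graphs of the model. -/
def IsLeadingOrder {R : ℕ} [NeZero R] (hR : Odd R) {V : Type}
    (G : Bubble (Option (ZMod R)) V) : Prop :=
  IsVacuumGraph hR G ∧
    ∀ (V' : Type) (G' : Bubble (Option (ZMod R)) V'),
      IsVacuumGraph hR G' → powerOfN G' ≤ powerOfN G

/-- A prime-complete generalized melon: a vacuum graph of index zero. -/
def IsGeneralizedMelon {R : ℕ} [NeZero R] (hR : Odd R) {V : Type}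
    (G : Bubble (Option (ZMod R)) V) : Prop :=
  IsVacuumGraph hR G ∧ G.index = 0

/-! The four conditions are compared through the numbers of faces `F₀ᵢ`. In a vacuum graph with `n`
interaction bubbles put `tᵢ = F₀ᵢ - 1 - n (R - 1) / 4` (`faceExcess`). Since `R` is prime, the edges
of two colors `i ≠ j` form a Hamiltonian cycle in the complete bubble, and counting faces in the
jackets gives `index = -(R - 1) / 2 * ∑ tᵢ` and `powerOfN = R + ∑ tᵢ`, while the genus of the
3-bubble with colors `0`, `i`, `j` is `-(tᵢ + tⱼ) / 2`. This genus is nonnegative (`genusBound`), so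
`∑ tᵢ ≤ 0`, and as the elementary mirror melon has all `tᵢ = 0`, each of the first three conditions
means that all `tᵢ` vanish (the graph is tight, `IsTight`). An insertion adds the excesses
(`faceExcess_insertion`), so mirror melons are tight.

The main tool is the switch of two edges of the same color (`IsSwitch`), whose effect on numbers of
components is given by `IsSwitch.numComps_add`. It proves the genus inequality, together with the
fact that graphs of genus zero are bipartite, by reduction to the graph with triple edges.

For the converse, let `G` be tight. By bipartiteness no edge of color `0` joins two vertices of the
same interaction bubble, and by counting (with a parity argument for `R = 3`) there is a face of
length two (`exists_length_two`), with vertices `x`, `y` in an interaction bubble `a` and `x'`, `y'`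
in another one `b`. For any other vertex `z` of `a`, joined to `x` and `y` by edges of colors `j` and
`k`, two switches and the genus inequality for `0`, `j`, `k` show that `z` is separated from the rest
of `a` and from `x'`, `y'` once `a` and `b` are dissolved (`exists_separating_set`). By parity and
counting, the component of `z` then meets `b` in exactly one point `z'` (`exists_two_point_set`). If
the edge of color `0` at some `z` leaves `a ∪ b`, then `G` is the insertion of a smaller graph in
another one; both are tight, since excesses add up and have nonpositive sums of pairs, so they are
mirror melons by induction, and mirror melons are closed under insertions. Otherwise `G` consists of
`a` and `b` only, all faces have length two, and `G` is the elementary mirror melon. -/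

/-! ### Counting classes of generated equivalence relations -/

section numClasses

variable {α β : Type}

theorem numClasses_congr {r s : α → α → Prop} (h₁ : ∀ a b, r a b → Relation.EqvGen s a b)
    (h₂ : ∀ a b, s a b → Relation.EqvGen r a b) : numClasses r = numClasses s := by
  refine Nat.card_congr
    ⟨Quot.lift (Quot.mk s) fun a b h => Quot.eqvGen_sound (h₁ a b h),
      Quot.lift (Quot.mk r) fun a b h => Quot.eqvGen_sound (h₂ a b h), ?_, ?_⟩
  · rintro ⟨a⟩; rfl
  · rintro ⟨a⟩; rfl

/-- A surjection whose fibers lie in single classes of `r` identifies the classes of `r` with those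
of the image relation. -/
theorem numClasses_eq_of_map {r : α → α → Prop} {s : β → β → Prop} (f : α → β) (g : β → α)
    (hf : ∀ a b, r a b → Relation.EqvGen s (f a) (f b))
    (hg : ∀ a b, s a b → Relation.EqvGen r (g a) (g b))
    (hfg : ∀ b, f (g b) = b) (hgf : ∀ a, Relation.EqvGen r (g (f a)) a) :
    numClasses r = numClasses s := by
  refine Nat.card_congr
    ⟨Quot.lift (fun a => Quot.mk s (f a)) fun a b h => Quot.eqvGen_sound (hf a b h),
      Quot.lift (fun a => Quot.mk r (g a)) fun a b h => Quot.eqvGen_sound (hg a b h), ?_, ?_⟩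
  · rintro ⟨a⟩; exact Quot.eqvGen_sound (hgf a)
  · rintro ⟨a⟩; exact congrArg (Quot.mk s) (hfg a)

open Classical in
/-- Adding the pair `(p, q)` to a relation merges two classes, unless `p` and `q` are already in the
same class. -/
theorem numClasses_add_pair [Finite α] (r : α → α → Prop) (p q : α) :
    numClasses r = numClasses (fun a b => r a b ∨ (a = p ∧ b = q)) +
      if Relation.EqvGen r p q then 0 else 1 := by
  set s : α → α → Prop := fun a b => r a b ∨ (a = p ∧ b = q) with hs
  split_ifs with h
  · refine numClasses_congr (fun a b hab => .rel _ _ (Or.inl hab)) ?_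
    rintro a b (hab | ⟨rfl, rfl⟩)
    · exact .rel _ _ hab
    · exact h
  · have hne : Quot.mk r p ≠ Quot.mk r q := fun e => h (Quot.eqvGen_exact e)
    have hpq : Quot.mk s p = Quot.mk s q := Quot.sound (Or.inr ⟨rfl, rfl⟩)
    let π : Quot r → Quot s := Quot.lift (Quot.mk s) fun a b hab => Quot.sound (Or.inl hab)
    let g : Quot s → Quot r := Quot.lift
      (fun a => if Quot.mk r a = Quot.mk r q then Quot.mk r p else Quot.mk r a) (by
        rintro a b (hab | ⟨rfl, rfl⟩)
        · simp only [Quot.sound hab]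
        · simp)
    have e : Quot s ≃ {c : Quot r // c ≠ Quot.mk r q} :=
      { toFun := fun c => ⟨g c, by
          obtain ⟨a⟩ := c
          change (if Quot.mk r a = Quot.mk r q then Quot.mk r p else Quot.mk r a) ≠ _
          split_ifs with h'
          · exact hne
          · exact h'⟩
        invFun := fun c => π c.1
        left_inv := by
          rintro ⟨a⟩
          change π (if Quot.mk r a = Quot.mk r q then Quot.mk r p else Quot.mk r a) = Quot.mk s a
          split_ifs with h'
          · change Quot.mk s p = Quot.mk s a
            rw [hpq]; exact (congrArg π h').symm
          · rfl
        right_inv := by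
          rintro ⟨⟨a⟩, ha⟩
          apply Subtype.ext
          change (if Quot.mk r a = Quot.mk r q then Quot.mk r p else Quot.mk r a) = Quot.mk r a
          rw [if_neg ha] }
    have : Finite (Quot r) := Quot.finite r
    have h1 : Nat.card (Quot s) = Nat.card {c : Quot r // c ≠ Quot.mk r q} := Nat.card_congr e
    have h2 : Nat.card (Quot r) = Nat.card (Option {c : Quot r // c ≠ Quot.mk r q}) :=
      Nat.card_congr (Equiv.optionSubtypeNe (Quot.mk r q)).symm
    rw [Finite.card_option] at h2
    simp only [numClasses]
    omega

theorem numClasses_pos [Finite α] [Nonempty α] (r : α → α → Prop) : 0 < numClasses r := by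
  have : Finite (Quot r) := Quot.finite r
  have : Nonempty (Quot r) := ⟨Quot.mk r (Classical.arbitrary α)⟩
  exact Nat.card_pos

theorem sum_ncard_classes [Fintype α] (r : α → α → Prop) [Fintype (Quot r)] :
    ∑ c : Quot r, {b | Quot.mk r b = c}.ncard = Fintype.card α := by
  classical
  rw [← Finset.card_univ, Finset.card_eq_sum_card_fiberwise (f := Quot.mk r) (t := Finset.univ)
    (fun _ _ => Finset.mem_coe.2 (Finset.mem_univ _))]
  refine Finset.sum_congr rfl fun c _ => ?_
  rw [← Set.ncard_coe_finset]
  congr 1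
  ext b
  simp

theorem ncard_class_mk (r : α → α → Prop) (a : α) :
    {b | Quot.mk r b = Quot.mk r a}.ncard = {b | Relation.EqvGen r a b}.ncard := by
  congr 1
  ext b
  exact ⟨fun hb => Quot.eqvGen_exact hb.symm, fun hb => (Quot.eqvGen_sound hb).symm⟩

/-- If all classes have at least `m` elements, then there are at most `|α| / m` classes. -/
theorem mul_numClasses_le [Finite α] (r : α → α → Prop) (m : ℕ)
    (h : ∀ a, m ≤ {b | Relation.EqvGen r a b}.ncard) : m * numClasses r ≤ Nat.card α := by
  have := Fintype.ofFinite α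
  have : Finite (Quot r) := Quot.finite r
  have := Fintype.ofFinite (Quot r)
  rw [numClasses, Nat.card_eq_fintype_card, Nat.card_eq_fintype_card, ← sum_ncard_classes r,
    ← Finset.card_univ, mul_comm, ← smul_eq_mul]
  refine Finset.card_nsmul_le_sum _ _ _ ?_
  rintro ⟨a⟩ -
  exact (h a).trans_eq (ncard_class_mk r a).symm

theorem mul_numClasses_eq [Finite α] (r : α → α → Prop) (m : ℕ)
    (h : ∀ a, {b | Relation.EqvGen r a b}.ncard = m) : m * numClasses r = Nat.card α := by
  have := Fintype.ofFinite α
  have : Finite (Quot r) := Quot.finite r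
  have := Fintype.ofFinite (Quot r)
  rw [numClasses, Nat.card_eq_fintype_card, Nat.card_eq_fintype_card, ← sum_ncard_classes r,
    ← Finset.card_univ, mul_comm, ← smul_eq_mul]
  refine (Finset.sum_eq_card_nsmul ?_).symm
  rintro ⟨a⟩ -
  exact (ncard_class_mk r a).trans (h a)

/-- If all classes have at least `m` elements and there are `|α| / m` classes, then all classes have
`m` elements. -/
theorem ncard_class_eq_of_mul_numClasses_eq [Finite α] (r : α → α → Prop) (m : ℕ)
    (h : ∀ a, m ≤ {b | Relation.EqvGen r a b}.ncard) (hm : m * numClasses r = Nat.card α) (a : α) :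
    {b | Relation.EqvGen r a b}.ncard = m := by
  have := Fintype.ofFinite α
  have : Finite (Quot r) := Quot.finite r
  have := Fintype.ofFinite (Quot r)
  rw [numClasses, Nat.card_eq_fintype_card, Nat.card_eq_fintype_card, ← sum_ncard_classes r,
    ← Finset.card_univ, mul_comm, ← smul_eq_mul, ← Finset.sum_const] at hm
  have := (Finset.sum_eq_sum_iff_of_le (by
    rintro ⟨a⟩ -
    exact (h a).trans_eq (ncard_class_mk r a).symm)).1 hm (Quot.mk r a) (Finset.mem_univ _)
  rw [this, ncard_class_mk]

end numClasses


namespace Bubble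

variable {C D V V' W : Type}

/-! ### Connectivity through a set of colors -/

/-- `v` and `w` are joined by a path of edges whose colors lie in `S`. -/
def ConnOn (B : Bubble C V) (S : Set C) (v w : V) : Prop :=
  Relation.EqvGen (fun v w => ∃ c ∈ S, B.inv c v = w) v w

/-- The number of connected components of the graph formed by all the vertices and the edges whose
colors lie in `S`. -/
noncomputable def numComps (B : Bubble C V) (S : Set C) : ℕ :=
  numClasses fun v w : V => ∃ c ∈ S, B.inv c v = w

section ConnOn

variable {B : Bubble C V} {S T : Set C} {u v w : V}

theorem ConnOn.refl (v : V) : B.ConnOn S v v := Relation.EqvGen.refl v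

theorem ConnOn.symm (h : B.ConnOn S v w) : B.ConnOn S w v := Relation.EqvGen.symm _ _ h

theorem ConnOn.trans (h : B.ConnOn S u v) (h' : B.ConnOn S v w) : B.ConnOn S u w :=
  Relation.EqvGen.trans _ _ _ h h'

theorem ConnOn.inv {c : C} (h : B.ConnOn S v w) (hc : c ∈ S) : B.ConnOn S v (B.inv c w) :=
  h.trans (.rel _ _ ⟨c, hc, rfl⟩)

theorem connOn_inv {c : C} (hc : c ∈ S) (v : V) : B.ConnOn S v (B.inv c v) :=
  (ConnOn.refl v).inv hc

theorem ConnOn.of_inv {c : C} (hc : c ∈ S) (h : B.inv c v = w) : B.ConnOn S v w :=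
  h ▸ connOn_inv hc v

/-- Paths between connected points can be replaced step by step. -/
theorem ConnOn.lift {B' : Bubble D V} {T : Set D} (h : B.ConnOn S v w)
    (hr : ∀ c ∈ S, ∀ u, B'.ConnOn T u (B.inv c u)) : B'.ConnOn T v w := by
  induction h with
  | rel a b hab => obtain ⟨c, hc, rfl⟩ := hab; exact hr c hc a
  | refl a => exact .refl a
  | symm a b _ ih => exact ih.symm
  | trans a b c _ _ ih₁ ih₂ => exact ih₁.trans ih₂

theorem ConnOn.mono (h : B.ConnOn S v w) (hST : S ⊆ T) : B.ConnOn T v w :=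
  h.lift fun _ hc u => connOn_inv (hST hc) u

theorem ConnOn.mem_iff {X : Set V} (h : B.ConnOn S v w)
    (hX : ∀ c ∈ S, ∀ u ∈ X, B.inv c u ∈ X) : v ∈ X ↔ w ∈ X := by
  induction h with
  | rel a b hab =>
    obtain ⟨c, hc, rfl⟩ := hab
    exact ⟨hX c hc a, fun h => by simpa [B.inv_inv] using hX c hc _ h⟩
  | refl a => rfl
  | symm a b _ ih => exact ih.symm
  | trans a b c _ _ ih₁ ih₂ => exact ih₁.trans ih₂

theorem ConnOn.map_eq {γ : Type} (κ : V → γ) (h : B.ConnOn S v w)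
    (hκ : ∀ c ∈ S, ∀ u, κ (B.inv c u) = κ u) : κ v = κ w := by
  have := (h.mem_iff (X := {u | κ u = κ v}) fun c hc u hu => (hκ c hc u).trans hu).1 rfl
  exact this.symm

end ConnOn

theorem numComponents_keep (B : Bubble C V) (f : D → C) :
    (B.keep f).numComponents = B.numComps (Set.range f) := by
  unfold numComponents numComps
  congr 1
  ext v w
  simp [keep]

theorem numFaces_eq (B : Bubble C V) (a b : C) : B.numFaces a b = B.numComps {a, b} := by
  rw [numFaces, numComponents_keep]
  congr 1
  simp [Set.pair_comm]

theorem numComponents_eq (B : Bubble C V) : B.numComponents = B.numComps Set.univ := by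
  unfold numComponents numComps
  simp

theorem numComps_congr {B B' : Bubble C V} {S : Set C} (h : ∀ c ∈ S, B.inv c = B'.inv c) :
    B.numComps S = B'.numComps S := by
  unfold numComps
  congr 1
  ext v w
  exact exists_congr fun c => and_congr_right fun hc => by rw [h c hc]

theorem numComps_eq_one_iff (B : Bubble C V) (S : Set C) :
    B.numComps S = 1 ↔ Nonempty V ∧ ∀ v w, B.ConnOn S v w := by
  unfold numComps numClasses
  rw [Nat.card_eq_one_iff_unique]
  constructor
  · rintro ⟨h, ⟨⟨v⟩⟩⟩
    exact ⟨⟨v⟩, fun v w => Quot.eqvGen_exact (Subsingleton.elim _ _)⟩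
  · rintro ⟨⟨v⟩, h⟩
    refine ⟨⟨?_⟩, ⟨Quot.mk _ v⟩⟩
    rintro ⟨a⟩ ⟨b⟩
    exact Quot.eqvGen_sound (h a b)

theorem numComps_eq_of_conn {B : Bubble C V} {B' : Bubble D V} {S : Set C} {T : Set D}
    (h : ∀ c ∈ S, ∀ u, B'.ConnOn T u (B.inv c u)) (h' : ∀ c ∈ T, ∀ u, B.ConnOn S u (B'.inv c u)) :
    B.numComps S = B'.numComps T :=
  numClasses_congr (by rintro a b ⟨c, hc, rfl⟩; exact h c hc a)
    (by rintro a b ⟨c, hc, rfl⟩; exact h' c hc a)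

/-! ### Parity and balance -/

theorem inv_eq_iff (B : Bubble C V) {c : C} {v w : V} : B.inv c v = w ↔ v = B.inv c w :=
  ⟨fun h => by rw [← h, B.inv_inv], fun h => by rw [h, B.inv_inv]⟩

theorem inv_injective (B : Bubble C V) (c : C) : Function.Injective (B.inv c) :=
  fun v w h => by rw [← B.inv_inv c v, h, B.inv_inv]

/-- The vertices of a set closed under one color come in pairs, so a function that changes sign
along the edges of this color has sum zero. -/
theorem sum_eq_zero_of_closed (B : Bubble C V) (c : C) (X : Finset V)
    (hX : ∀ u ∈ X, B.inv c u ∈ X) (φ : V → ℤ) (hφ : ∀ u ∈ X, φ u + φ (B.inv c u) = 0) :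
    ∑ u ∈ X, φ u = 0 :=
  Finset.sum_involution (fun u _ => B.inv c u) hφ (fun u _ _ => B.inv_ne c u) hX
    (fun u _ => B.inv_inv c u)

theorem even_ncard_of_closed [Finite V] (B : Bubble C V) (c : C) (X : Set V)
    (hX : ∀ u ∈ X, B.inv c u ∈ X) : Even X.ncard := by
  classical
  have := Fintype.ofFinite V
  have h : ∑ u ∈ X.toFinset, (1 : ZMod 2) = 0 :=
    Finset.sum_involution (fun u _ => B.inv c u) (fun _ _ => by decide)
      (fun u _ _ => B.inv_ne c u) (by simpa using hX) (fun u _ => B.inv_inv c u)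
  rw [Set.ncard_eq_toFinset_card']
  simpa [ZMod.natCast_eq_zero_iff_even] using h

/-- A set closed under one color cannot be, after removal of one of its points, closed under
another one. -/
theorem not_closed_of_closed [Finite V] (B B' : Bubble C V) (g h : C) (X : Set V) (p : V)
    (hp : p ∈ X) (hg : ∀ u ∈ X, B.inv g u ∈ X)
    (hh : ∀ u ∈ X, u ≠ p → B'.inv h u ∈ X ∧ B'.inv h u ≠ p) : False := by
  have h1 := B.even_ncard_of_closed g X hg
  have h2 := B'.even_ncard_of_closed h (X \ {p}) fun u hu => hh u hu.1 hu.2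
  have h3 := Set.ncard_sdiff_singleton_add_one hp
  rw [← h3, Nat.even_add_one] at h1
  exact h1 h2

/-! ### Switching two edges of the same color -/

/-- `B'` is obtained from `B` by replacing the edges of color `c` at `p` and `q`, say `p p'` and
`q q'`, by edges `p q` and `p' q'` of the same color. -/
structure IsSwitch (B B' : Bubble C V) (c : C) (p q : V) : Prop where
  ne : p ≠ q
  inv_ne : B.inv c p ≠ q
  of_ne : ∀ d, d ≠ c → B'.inv d = B.inv d
  left : B'.inv c p = q
  right : B'.inv c (B.inv c p) = B.inv c q
  other : ∀ u, u ≠ p → u ≠ q → u ≠ B.inv c p → u ≠ B.inv c q → B'.inv c u = B.inv c u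

namespace IsSwitch

variable {B B' : Bubble C V} {c : C} {p q : V}

theorem left' (h : IsSwitch B B' c p q) : B'.inv c q = p := by
  rw [B'.inv_eq_iff, h.left]

theorem right' (h : IsSwitch B B' c p q) : B'.inv c (B.inv c q) = B.inv c p := by
  rw [B'.inv_eq_iff, h.right]

/-- The switch that undoes a switch. -/
theorem reverse (h : IsSwitch B B' c p q) : IsSwitch B' B c p (B.inv c p) where
  ne := (B.inv_ne c p).symm
  inv_ne := by rw [h.left]; exact h.inv_ne.symm
  of_ne d hd := (h.of_ne d hd).symm
  left := rfl
  right := by rw [h.left, h.right]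
  other u h1 h2 h3 h4 := by
    rw [h.left] at h3
    rw [h.right] at h4
    exact (h.other u h1 h3 h2 h4).symm

theorem conn_mono (h : IsSwitch B B' c p q) {S : Set C} (hc : c ∈ S)
    (hp : B'.ConnOn S p (B.inv c p)) {v w : V} (hvw : B.ConnOn S v w) : B'.ConnOn S v w := by
  refine hvw.lift fun d hd u => ?_
  by_cases hdc : d = c
  · subst hdc
    have hpq : B'.ConnOn S p q := .of_inv hc h.left
    have hpq' : B'.ConnOn S (B.inv d p) (B.inv d q) := .of_inv hc h.right
    by_cases h1 : u = p
    · rw [h1]; exact hp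
    by_cases h2 : u = q
    · rw [h2]; exact (hpq.symm.trans hp).trans hpq'
    by_cases h3 : u = B.inv d p
    · rw [h3, B.inv_inv]; exact hp.symm
    by_cases h4 : u = B.inv d q
    · rw [h4, B.inv_inv]; exact (hpq'.symm.trans hp.symm).trans hpq
    rw [← h.other u h1 h2 h3 h4]
    exact connOn_inv hc u
  · rw [← h.of_ne d hdc]
    exact connOn_inv hd u

open Classical in
/-- Both graphs of a switch become the same, up to connectivity, when the four vertices are
connected. This needs the additional edge `p q` for `B` and the additional edge `p p'` for `B'`. -/
theorem numComps_add [Finite V] (h : IsSwitch B B' c p q) {S : Set C} (hc : c ∈ S) :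
    B.numComps S + (if B'.ConnOn S p (B.inv c p) then 0 else 1) =
      B'.numComps S + (if B.ConnOn S p q then 0 else 1) := by
  have key : ∀ {B B' : Bubble C V} {p q : V}, IsSwitch B B' c p q → ∀ a b,
      ((∃ d ∈ S, B.inv d a = b) ∨ (a = p ∧ b = q)) → Relation.EqvGen
        (fun a b => (∃ d ∈ S, B'.inv d a = b) ∨ (a = p ∧ b = B.inv c p)) a b := by
    intro B B' p q h a b hab
    have mono : ∀ {v w}, B'.ConnOn S v w → Relation.EqvGen
        (fun a b => (∃ d ∈ S, B'.inv d a = b) ∨ (a = p ∧ b = B.inv c p)) v w :=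
      fun hvw => Relation.EqvGen.mono (fun _ _ => Or.inl) _ _ hvw
    have hpq := mono (.of_inv hc h.left)
    have hpq' := mono (.of_inv hc h.right)
    have hp : Relation.EqvGen
        (fun a b => (∃ d ∈ S, B'.inv d a = b) ∨ (a = p ∧ b = B.inv c p)) p (B.inv c p) :=
      .rel _ _ (Or.inr ⟨rfl, rfl⟩)
    rcases hab with ⟨d, hd, rfl⟩ | ⟨rfl, rfl⟩
    · by_cases hdc : d = c
      · subst hdc
        by_cases h1 : a = p
        · rw [h1]; exact hp
        by_cases h2 : a = q
        · rw [h2]; exact (hpq.symm.trans _ _ _ hp).trans _ _ _ hpq'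
        by_cases h3 : a = B.inv d p
        · rw [h3, B.inv_inv]; exact hp.symm
        by_cases h4 : a = B.inv d q
        · rw [h4, B.inv_inv]; exact (hpq'.symm.trans _ _ _ hp.symm).trans _ _ _ hpq
        rw [← h.other a h1 h2 h3 h4]
        exact mono (connOn_inv hc a)
      · rw [← h.of_ne d hdc]
        exact mono (connOn_inv hd a)
    · exact hpq
  have h1 := numClasses_add_pair (fun v w => ∃ d ∈ S, B.inv d v = w) p q
  have h2 := numClasses_add_pair (fun v w => ∃ d ∈ S, B'.inv d v = w) p (B.inv c p)
  have h3 := numClasses_congr (key h) (by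
    intro a b hab
    have := key h.reverse a b hab
    rwa [h.left] at this)
  unfold numComps ConnOn
  rw [h1, h2, h3]
  omega

theorem numComps_of_notMem (h : IsSwitch B B' c p q) {S : Set C} (hc : c ∉ S) :
    B'.numComps S = B.numComps S :=
  numComps_congr fun d hd => h.of_ne d fun e => hc (e ▸ hd)

/-- In a graph with two colors the two edges of a switch are in the same cycle before the switch,
or the four vertices are in the same cycle afterwards. -/
theorem conn_or_conn [Finite V] (h : IsSwitch B B' c p q) {g : C} (hg : g ≠ c) {S : Set C}
    (hc : c ∈ S) (hgS : g ∈ S) : B.ConnOn S p q ∨ B'.ConnOn S p (B.inv c p) := by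
  by_contra! hn
  obtain ⟨hX, hY⟩ := hn
  refine B.not_closed_of_closed B g c {u | B.ConnOn S p u ∧ B'.ConnOn S p u} p
    ⟨.refl p, .refl p⟩ (fun u hu => ⟨hu.1.inv hgS, ?_⟩) (fun u hu hup => ?_)
  · rw [← h.of_ne g hg]; exact hu.2.inv hgS
  · have h2 : u ≠ q := fun e => hX (e ▸ hu.1)
    have h3 : u ≠ B.inv c p := fun e => hY (e ▸ hu.2)
    have h4 : u ≠ B.inv c q := fun e => hY (by
      have := hu.2.inv hc
      rwa [e, h.right'] at this)
    refine ⟨⟨hu.1.inv hc, ?_⟩, fun e => h3 (B.inv_eq_iff.1 e)⟩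
    rw [← h.other u hup h2 h3 h4]
    exact hu.2.inv hc

end IsSwitch

open Classical in
theorem exists_isSwitch (B : Bubble C V) (c : C) {p q : V} (hpq : p ≠ q) (hq : B.inv c p ≠ q) :
    ∃ B' : Bubble C V, IsSwitch B B' c p q := by
  have hq' : B.inv c q ≠ p := fun e => hq (by rw [← e, B.inv_inv])
  have hpq' : B.inv c p ≠ B.inv c q := fun e => hpq (B.inv_injective c e)
  have hp1 := B.inv_ne c p
  have hq1 := B.inv_ne c q
  have k := B.inv_inv
  refine ⟨⟨fun d u => if d = c then
      (if u = p then q else if u = q then p else if u = B.inv c p then B.inv c q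
        else if u = B.inv c q then B.inv c p else B.inv c u) else B.inv d u, ?_, ?_⟩,
    hpq, hq, ?_, ?_, ?_, ?_⟩
  · intro d u
    by_cases hd : d = c
    · subst hd
      simp only [if_true]
      by_cases h1 : u = p
      · simp [h1, hpq.symm]
      by_cases h2 : u = q
      · simp [h2, hpq.symm]
      by_cases h3 : u = B.inv d p
      · simp [h3, hp1, hq, hq', hq1, hpq'.symm]
      by_cases h4 : u = B.inv d q
      · simp [h4, hp1, hq, hq', hq1, hpq'.symm]
      have e1 : B.inv d u ≠ p := fun e => h3 (B.inv_eq_iff.1 e)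
      have e2 : B.inv d u ≠ q := fun e => h4 (B.inv_eq_iff.1 e)
      have e3 : B.inv d u ≠ B.inv d p := fun e => h1 (B.inv_injective d e)
      have e4 : B.inv d u ≠ B.inv d q := fun e => h2 (B.inv_injective d e)
      simp [h1, h2, h3, h4, e1, e2, e3, e4, k]
    · simp [hd, k]
  · intro d u
    by_cases hd : d = c
    · subst hd
      simp only [if_true]
      by_cases h1 : u = p
      · simp [h1, hpq.symm]
      by_cases h2 : u = q
      · simp [h2, hpq, hpq.symm]
      by_cases h3 : u = B.inv d p
      · simp [h3, hp1, hq, hpq'.symm]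
      by_cases h4 : u = B.inv d q
      · simp [h4, hq', hq1, hpq', hpq'.symm]
      simp [h1, h2, h3, h4, B.inv_ne]
    · simp [hd, B.inv_ne]
  · intro d hd; funext u; simp [hd]
  · simp
  · simp [hp1, hq]
  · intro u h1 h2 h3 h4; simp [h1, h2, h3, h4]

end Bubble

namespace Bubble

variable {C V : Type}

/-! ### The genus inequality for three colors -/

/-- A two-coloring of the vertices, such that every edge of the colors in `S` has ends of different
types. -/
def IsTwoColoring (B : Bubble C V) (S : Set C) (s : V → Bool) : Prop :=
  ∀ c ∈ S, ∀ u, s (B.inv c u) = !s u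

theorem setOf_connOn_singleton (B : Bubble C V) (c : C) (v : V) :
    {w | B.ConnOn {c} v w} = {v, B.inv c v} := by
  ext w
  constructor
  · intro h
    refine (h.mem_iff (X := {v, B.inv c v}) ?_).1 (by simp)
    rintro _ rfl u (rfl | rfl)
    · simp
    · simp [B.inv_inv]
  · rintro (rfl | rfl)
    · exact .refl _
    · exact connOn_inv (Set.mem_singleton c) _

theorem two_mul_numComps_singleton [Finite V] (B : Bubble C V) (c : C) :
    2 * B.numComps {c} = Nat.card V := by
  have h2 : ∀ v, {w | B.ConnOn {c} v w}.ncard = 2 := fun v => by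
    rw [setOf_connOn_singleton, Set.ncard_pair (B.inv_ne c v).symm]
  exact mul_numClasses_eq _ 2 h2

/-- The graph with a single color is a disjoint union of edges, so it has a two-coloring. -/
theorem exists_isTwoColoring_singleton (B : Bubble C V) (c : C) :
    ∃ s, B.IsTwoColoring {c} s := by
  classical
  let r : V → V → Prop := fun v w => ∃ d ∈ ({c} : Set C), B.inv d v = w
  have hout : ∀ v, (Quot.mk r v).out = v ∨ (Quot.mk r v).out = B.inv c v := fun v => by
    have : B.ConnOn {c} v (Quot.mk r v).out := Quot.eqvGen_exact (Quot.out_eq _).symm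
    have h : (Quot.mk r v).out ∈ {w | B.ConnOn {c} v w} := this
    rw [setOf_connOn_singleton] at h
    exact h
  have hq : ∀ v, Quot.mk r (B.inv c v) = Quot.mk r v := fun v => (Quot.sound ⟨c, rfl, rfl⟩).symm
  refine ⟨fun v => decide ((Quot.mk r v).out = v), ?_⟩
  intro d hd u
  rw [Set.mem_singleton_iff.1 hd]
  simp only [hq]
  have := B.inv_ne c u
  rcases hout u with h | h
  · rw [h]; simp [this.symm]
  · rw [h]; simp [this]

/-- The genus inequality for the colors `f`, `g`, `h`, together with the fact that the graph is
bipartite when the genus is zero. -/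
def GenusBound (B : Bubble C V) (f g h : C) : Prop :=
  2 * (B.numComps {f, g} + B.numComps {f, h} + B.numComps {g, h}) ≤
      4 * B.numComps {f, g, h} + Nat.card V ∧
    (2 * (B.numComps {f, g} + B.numComps {f, h} + B.numComps {g, h}) =
      4 * B.numComps {f, g, h} + Nat.card V → ∃ s, B.IsTwoColoring {f, g, h} s)

theorem GenusBound.swap {B : Bubble C V} {f g h : C} (H : B.GenusBound f g h) :
    B.GenusBound f h g := by
  unfold GenusBound at *
  rw [Set.pair_comm h g, show B.numComps {f, h} + B.numComps {f, g} +
    B.numComps {g, h} = B.numComps {f, g} + B.numComps {f, h} + B.numComps {g, h} by ring]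
  exact H

/-- A two-coloring of the switched graph which is adapted to the switched edges is one of the
original graph. -/
theorem IsSwitch.isTwoColoring {B B' : Bubble C V} {c : C} {p q : V} (h : IsSwitch B B' c p q)
    {S : Set C} (hc : c ∈ S) {s : V → Bool} (hs : B'.IsTwoColoring S s)
    (hp : s (B.inv c p) = !s p) : B.IsTwoColoring S s := by
  intro d hd u
  by_cases hdc : d = c
  · subst hdc
    have e1 := hs d hc p
    have e2 := hs d hc (B.inv d p)
    rw [h.left] at e1
    rw [h.right] at e2
    by_cases h1 : u = p
    · rw [h1]; exact hp
    by_cases h2 : u = q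
    · rw [h2, e2, e1, hp]
    by_cases h3 : u = B.inv d p
    · rw [h3, B.inv_inv, hp]; simp
    by_cases h4 : u = B.inv d q
    · rw [h4, B.inv_inv, e2, e1, hp]; simp
    rw [← h.other u h1 h2 h3 h4]
    exact hs d hd u
  · rw [← h.of_ne d hdc]
    exact hs d hd u

/-- Replacing the edges of color `h` at the two ends of an edge of color `f` by an edge parallel to
it, and an edge between the other two ends, preserves the genus inequality. -/
theorem GenusBound.of_isSwitch [Finite V] {B B' : Bubble C V} {f g h : C} (hfg : f ≠ g)
    (hfh : f ≠ h) (hgh : g ≠ h) {p : V} (hs : IsSwitch B B' h p (B.inv f p))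
    (H : B'.GenusBound f g h) : B.GenusBound f g h := by
  set q := B.inv f p with hq
  have Nfg : B'.numComps {f, g} = B.numComps {f, g} :=
    hs.numComps_of_notMem (by simp [hfh.symm, hgh.symm])
  have Nfh := hs.numComps_add (S := {f, h}) (by simp)
  have Ngh := hs.numComps_add (S := {g, h}) (by simp)
  have Nfgh := hs.numComps_add (S := {f, g, h}) (by simp)
  have c1 : B.ConnOn {f, h} p q := connOn_inv (by simp) p
  have c2 : B.ConnOn {f, g, h} p q := connOn_inv (by simp) p
  have c3 : ¬ B'.ConnOn {f, h} p (B.inv h p) := by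
    intro hc
    have := (hc.mem_iff (X := {p, q}) (by
      rintro d (rfl | rfl) u (rfl | rfl)
      · rw [hs.of_ne _ hfh]; simp [hq]
      · rw [hs.of_ne _ hfh, hq, B.inv_inv]; simp
      · rw [hs.left]; simp
      · rw [hs.left']; simp)).1 (by simp)
    rcases this with e | e
    · exact B.inv_ne h p e
    · exact hs.inv_ne e
  rw [if_pos c1, if_neg c3] at Nfh
  rw [if_pos c2] at Nfgh
  obtain ⟨H1, H2⟩ := H
  -- A two-coloring of `B'` with different values at `p` and its old neighbor is one of `B`.
  have finish : (∃ s, B'.IsTwoColoring {f, g, h} s ∧ s (B.inv h p) = !s p) →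
      ∃ s, B.IsTwoColoring {f, g, h} s :=
    fun ⟨s, hs1, hs2⟩ => ⟨s, hs.isTwoColoring (by simp) hs1 hs2⟩
  by_cases hcon : B'.ConnOn {f, g, h} p (B.inv h p)
  · rw [if_pos hcon] at Nfgh
    have hle : B.numComps {g, h} ≤ B'.numComps {g, h} + 1 := by
      split_ifs at Ngh <;> omega
    refine ⟨by omega, fun heq => finish ?_⟩
    obtain ⟨s, hs'⟩ := H2 (by omega)
    refine ⟨s, hs', ?_⟩
    have hpq : ¬ B.ConnOn {g, h} p q := by
      intro hc
      rw [if_pos hc] at Ngh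
      split_ifs at Ngh <;> omega
    -- The cycle of colors `g`, `h` through `p` in `B` avoids `q`. It is balanced with respect to
    -- the edges of color `g`, and, away from `p` and its neighbor, to those of color `h`.
    classical
    have := Fintype.ofFinite V
    let X : Finset V := Finset.univ.filter fun u => B.ConnOn {g, h} p u
    let φ : V → ℤ := fun u => if s u then 1 else -1
    have hX : ∀ u, u ∈ X ↔ B.ConnOn {g, h} p u := fun u => by simp [X]
    have hflip : ∀ c ∈ ({f, g, h} : Set C), ∀ u, φ u + φ (B'.inv c u) = 0 := by
      intro c hc u
      simp only [φ, hs' c hc u]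
      cases s u <;> simp
    have s1 : ∑ u ∈ X, φ u = 0 := by
      refine B'.sum_eq_zero_of_closed g X (fun u hu => ?_) φ (fun u _ => hflip g (by simp) u)
      rw [hX] at hu ⊢
      rw [hs.of_ne g hgh]; exact hu.inv (by simp)
    have hp' : B.inv h p ∈ X := (hX _).2 (connOn_inv (by simp) p)
    have hpX : p ∈ X.erase (B.inv h p) :=
      Finset.mem_erase.2 ⟨(B.inv_ne h p).symm, (hX _).2 (.refl p)⟩
    have s2 : ∑ u ∈ (X.erase (B.inv h p)).erase p, φ u = 0 := by
      refine B'.sum_eq_zero_of_closed h _ (fun u hu => ?_) φ (fun u _ => hflip h (by simp) u)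
      simp only [Finset.mem_erase, hX] at hu ⊢
      obtain ⟨u1, u3, hu⟩ := hu
      have u2 : u ≠ q := fun e => hpq (e ▸ hu)
      have u4 : u ≠ B.inv h q := fun e => hpq (by
        have := hu.inv (c := h) (by simp)
        rwa [e, B.inv_inv] at this)
      rw [hs.other u u1 u2 u3 u4]
      exact ⟨fun e => u3 (B.inv_eq_iff.1 e), fun e => u1 (B.inv_injective h e), hu.inv (by simp)⟩
    have s3 := Finset.add_sum_erase X φ hp'
    have s4 := Finset.add_sum_erase _ φ hpX
    have s5 : φ (B.inv h p) + φ p = 0 := by omega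
    simp only [φ] at s5
    cases h1 : s p <;> cases h2 : s (B.inv h p) <;> simp [h1, h2] at s5 ⊢
  · rw [if_neg hcon] at Nfgh
    have hgh' : ¬ B'.ConnOn {g, h} p (B.inv h p) := fun hc => hcon (hc.mono (by simp))
    have hpq : B.ConnOn {g, h} p q :=
      (hs.conn_or_conn hgh (by simp) (by simp)).resolve_right hgh'
    rw [if_neg hgh', if_pos hpq] at Ngh
    refine ⟨by omega, fun heq => finish ?_⟩
    obtain ⟨s, hs'⟩ := H2 (by omega)
    by_cases hsp : s (B.inv h p) = !s p
    · exact ⟨s, hs', hsp⟩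
    · classical
      -- The two-coloring can be reversed on the component of `p` only.
      refine ⟨fun u => if B'.ConnOn {f, g, h} p u then !s u else s u, fun c hc u => ?_, ?_⟩
      · have : B'.ConnOn {f, g, h} p (B'.inv c u) ↔ B'.ConnOn {f, g, h} p u :=
          ⟨fun h' => by simpa [B'.inv_inv] using h'.inv hc, fun h' => h'.inv hc⟩
        simp only [this, hs' c hc u]
        split_ifs <;> rfl
      · simp only [hcon, if_false, ConnOn.refl, if_true]
        simpa using hsp

/-- The genus of a graph with three colors is nonnegative, and the graph is bipartite if the genus
is zero. By switches all the edges become triple edges, for which both facts are clear. -/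
theorem genusBound [Finite V] {f g h : C} (hfg : f ≠ g) (hfh : f ≠ h) (hgh : g ≠ h)
    (B : Bubble C V) : B.GenusBound f g h := by
  have main : ∀ (n : ℕ) (g h : C), f ≠ g → f ≠ h → g ≠ h → ∀ B : Bubble C V,
      {v | B.inv g v ≠ B.inv f v}.ncard + {v | B.inv h v ≠ B.inv f v}.ncard = n →
      B.GenusBound f g h := by
    intro n
    induction n using Nat.strong_induction_on with
    | _ n ih =>
    have step : ∀ (g h : C), f ≠ g → f ≠ h → g ≠ h → ∀ B : Bubble C V,
        {v | B.inv g v ≠ B.inv f v}.ncard + {v | B.inv h v ≠ B.inv f v}.ncard = n →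
        (∃ v, B.inv h v ≠ B.inv f v) → B.GenusBound f g h := by
      rintro g h hfg hfh hgh B hn ⟨p, hp⟩
      obtain ⟨B', hs⟩ := B.exists_isSwitch h (B.inv_ne f p).symm hp
      refine .of_isSwitch hfg hfh hgh hs (ih _ ?_ g h hfg hfh hgh B' rfl)
      rw [← hn, hs.of_ne g hgh, hs.of_ne f hfh]
      refine Nat.add_lt_add_left (Set.ncard_lt_ncard ⟨fun u hu hu' => ?_, fun hsub => ?_⟩) _
      · by_cases h1 : u = p
        · exact hu (by rw [h1, hs.left])
        by_cases h2 : u = B.inv f p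
        · exact hu (by rw [h2, hs.left', B.inv_inv])
        by_cases h3 : u = B.inv h p
        · rw [h3, B.inv_inv] at hu'
          exact h2 (by rw [h3]; rw [eq_comm, B.inv_eq_iff] at hu'; exact hu')
        by_cases h4 : u = B.inv h (B.inv f p)
        · rw [h4, B.inv_inv] at hu'
          exact h1 (by rw [h4]; exact (B.inv_injective f hu').symm)
        exact hu (by rw [hs.other u h1 h2 h3 h4, hu'])
      · exact hsub hp hs.left
    intro g h hfg hfh hgh B hn
    by_cases hh : ∃ v, B.inv h v ≠ B.inv f v
    · exact step g h hfg hfh hgh B hn hh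
    by_cases hg : ∃ v, B.inv g v ≠ B.inv f v
    · exact (step h g hfh hfg hgh.symm B (by omega) hg).swap
    push Not at hh hg
    have e : ∀ S ⊆ ({f, g, h} : Set C), S.Nonempty → B.numComps S = B.numComps {f} := by
      rintro S hS ⟨d, hd⟩
      have hf : ∀ c ∈ ({f, g, h} : Set C), B.inv c = B.inv f := by
        rintro c (rfl | rfl | rfl)
        · rfl
        · exact funext hg
        · exact funext hh
      refine numComps_eq_of_conn (fun c hc u => ?_) (fun c hc u => ?_)
      · rw [hf c (hS hc)]; exact connOn_inv (Set.mem_singleton f) u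
      · rw [Set.mem_singleton_iff.1 hc, ← hf d (hS hd)]; exact connOn_inv hd u
    have := B.two_mul_numComps_singleton f
    unfold GenusBound
    rw [e {f, g} (by grind) (by simp), e {f, h} (by grind) (by simp), e {g, h} (by grind) (by simp),
      e {f, g, h} (by grind) (by simp)]
    refine ⟨by omega, fun _ => ?_⟩
    obtain ⟨s, hs⟩ := B.exists_isTwoColoring_singleton f
    refine ⟨s, ?_⟩
    rintro c (rfl | rfl | rfl) u
    · exact hs _ rfl u
    · rw [hg]; exact hs _ rfl u
    · rw [hh]; exact hs _ rfl u
  exact main _ g h hfg hfh hgh B rfl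

end Bubble

/-! ### Cyclic orderings -/

namespace CyclicOrdering

open Equiv Equiv.Perm

variable {C : Type}

theorem exists_map_pair {a b a' b' : C} (h : a ≠ b) (h' : a' ≠ b') :
    ∃ π : Perm C, π a = a' ∧ π b = b' :=
  (MulAction.is_two_pretransitive_iff (G := Perm C) (α := C)).1
    (Perm.isMultiplyPretransitive C 2) h h'

variable [Fintype C]

theorem isCycleOn_univ_iff_cycleType [DecidableEq C] [Nontrivial C] (σ : Perm C) :
    σ.IsCycleOn _root_.Set.univ ↔ σ.cycleType = {Fintype.card C} := by
  constructor
  · intro h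
    have hs : σ.support = Finset.univ := by
      ext x
      simpa using h.apply_ne _root_.Set.nontrivial_univ (_root_.Set.mem_univ x)
    have hc : σ.IsCycle :=
      isCycle_iff_exists_isCycleOn.2 ⟨_, _root_.Set.nontrivial_univ, h, fun _ _ => _root_.Set.mem_univ _⟩
    rw [hc.cycleType, hs, Finset.card_univ]
  · intro h
    have hc : σ.IsCycle := by rw [← card_cycleType_eq_one, h]; simp
    have hs : σ.support = Finset.univ := by
      rw [← Finset.card_eq_iff_eq_univ, ← sum_cycleType, h]; simp
    have : {x | σ x ≠ x} = _root_.Set.univ := by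
      ext x
      have : x ∈ σ.support := hs ▸ Finset.mem_univ x
      simpa using this
    rw [← this]
    exact hc.isCycleOn

open Classical in
/-- The set of the cyclic orderings of `C`. -/
noncomputable def fullCycles (C : Type) [Fintype C] : Finset (Perm C) :=
  Finset.univ.filter fun σ : Perm C => σ.IsCycleOn _root_.Set.univ

theorem mem_fullCycles {σ : Perm C} : σ ∈ fullCycles C ↔ σ.IsCycleOn _root_.Set.univ := by
  simp [fullCycles]

theorem card_fullCycles (h : 2 ≤ Fintype.card C) :
    (fullCycles C).card = (Fintype.card C - 1).factorial := by
  classical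
  have : Nontrivial C := Fintype.one_lt_card_iff_nontrivial.1 h
  have e := card_of_cycleType_singleton h le_rfl
  rw [Nat.choose_self, mul_one] at e
  rw [← e, fullCycles]
  congr 1
  ext σ
  simp [isCycleOn_univ_iff_cycleType]

open Classical in
/-- The number of cyclic orderings in which `b` comes right after `a`. -/
noncomputable def numSuccessor (a b : C) : ℕ := ((fullCycles C).filter fun σ => σ a = b).card

theorem numSuccessor_map (π : Perm C) (a b : C) :
    numSuccessor (π a) (π b) = numSuccessor a b := by
  classical
  have key : ∀ (π σ : Perm C), σ ∈ fullCycles C → π * σ * π⁻¹ ∈ fullCycles C := by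
    intro π σ h
    rw [mem_fullCycles] at h ⊢
    have := h.conj (g := π)
    rwa [Set.image_univ, π.surjective.range_eq] at this
  refine Finset.card_bij' (fun σ _ => π⁻¹ * σ * π) (fun σ _ => π * σ * π⁻¹) ?_ ?_ ?_ ?_
  · intro σ hσ
    rw [Finset.mem_filter] at hσ ⊢
    refine ⟨by simpa using key π⁻¹ σ hσ.1, ?_⟩
    simp [hσ.2]
  · intro σ hσ
    rw [Finset.mem_filter] at hσ ⊢
    refine ⟨key π σ hσ.1, ?_⟩
    simp [hσ.2]
  · intro σ _; group
  · intro σ _; group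

theorem numSuccessor_eq (h : 2 ≤ Fintype.card C) {a b : C} (hab : a ≠ b) :
    numSuccessor a b = (Fintype.card C - 2).factorial := by
  classical
  have : Nontrivial C := Fintype.one_lt_card_iff_nontrivial.1 h
  have e1 : (fullCycles C).card = ∑ x ∈ Finset.univ.erase a, numSuccessor a x :=
    Finset.card_eq_sum_card_fiberwise (f := fun σ : Perm C => σ a) (fun σ hσ => by
      have := (mem_fullCycles.1 hσ).apply_ne _root_.Set.nontrivial_univ (_root_.Set.mem_univ a)
      simpa using this)
  have e2 : ∀ x ∈ Finset.univ.erase a, numSuccessor a x = numSuccessor a b := by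
    intro x hx
    obtain ⟨π, h1, h2⟩ := exists_map_pair (Finset.ne_of_mem_erase hx).symm hab
    rw [← numSuccessor_map π, h1, h2]
  rw [Finset.sum_congr rfl e2, Finset.sum_const, Finset.card_erase_of_mem (Finset.mem_univ a),
    Finset.card_univ, card_fullCycles h, smul_eq_mul] at e1
  obtain ⟨m, hm⟩ := Nat.exists_eq_add_of_le h
  rw [hm, show 2 + m - 1 = m + 1 by omega, Nat.factorial_succ] at e1
  rw [hm, show 2 + m - 2 = m by omega]
  exact (Nat.eq_of_mul_eq_mul_left (Nat.succ_pos m) e1).symm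

open Classical in
/-- Every ordered pair of distinct elements is consecutive in the same number of cyclic
orderings. -/
theorem sum_fullCycles (h : 2 ≤ Fintype.card C) (φ : C → C → ℚ) :
    ∑ σ ∈ fullCycles C, ∑ c, φ c (σ c) =
      (Fintype.card C - 2).factorial * ∑ a, ∑ b, if a = b then 0 else φ a b := by
  have : Nontrivial C := Fintype.one_lt_card_iff_nontrivial.1 h
  rw [Finset.sum_comm, Finset.mul_sum]
  refine Finset.sum_congr rfl fun a _ => ?_
  rw [Finset.mul_sum, ← Finset.sum_fiberwise_of_maps_to (t := Finset.univ) (g := fun σ : Perm C => σ a)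
    (fun _ _ => Finset.mem_univ _)]
  refine Finset.sum_congr rfl fun b _ => ?_
  rw [Finset.sum_congr rfl (g := fun _ => φ a b) fun σ hσ => by rw [(Finset.mem_filter.1 hσ).2],
    Finset.sum_const, nsmul_eq_mul]
  change (numSuccessor a b : ℚ) * _ = _
  split_ifs with hab
  · subst hab
    have : numSuccessor a a = 0 := by
      rw [numSuccessor, Finset.card_eq_zero, Finset.filter_eq_empty_iff]
      exact fun σ hσ =>
        (mem_fullCycles.1 hσ).apply_ne _root_.Set.nontrivial_univ (_root_.Set.mem_univ a)
    rw [this]; simp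
  · rw [numSuccessor_eq h hab]

end CyclicOrdering

theorem numClasses_sigma {ι β : Type} [Fintype ι] [Finite β] (r : ι → β → β → Prop) :
    numClasses (fun p q : ι × β => p.1 = q.1 ∧ r p.1 p.2 q.2) = ∑ i, numClasses (r i) := by
  have (i : ι) : Finite (Quot (r i)) := Quot.finite _
  unfold numClasses
  rw [← Nat.card_sigma]
  refine Nat.card_congr
    ⟨Quot.lift (fun p => ⟨p.1, Quot.mk _ p.2⟩) ?_,
      fun x => Quot.lift (fun b => Quot.mk _ (x.1, b)) (fun a b h => Quot.sound ⟨rfl, h⟩) x.2,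
      ?_, ?_⟩
  · rintro ⟨i, a⟩ ⟨j, b⟩ ⟨h1, h2⟩
    dsimp only at h1 h2
    subst h1
    rw [Quot.sound h2]
  · rintro ⟨i, a⟩; rfl
  · rintro ⟨i, ⟨a⟩⟩; rfl

/-! ### Jackets and the degree -/

namespace Bubble

variable {C V : Type}

theorem jacket_rot (B : Bubble C V) (σ : Equiv.Perm C) (v : V) (c : C) :
    (B.jacket σ ∅).rot (v, c) = (v, σ c) := by
  simp [jacket]

theorem jacket_edge (B : Bubble C V) (σ : Equiv.Perm C) (v : V) (c : C) :
    (B.jacket σ ∅).edge (v, c) = (B.inv c v, c) := rfl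

theorem jacket_twisted (B : Bubble C V) (σ : Equiv.Perm C) (p : V × C) :
    (B.jacket σ ∅).twisted p := by
  simp [jacket]

theorem eqvGen_rot {σ : Equiv.Perm C} {r : V × C → V × C → Prop}
    (hr : ∀ v c, Relation.EqvGen r (v, c) (v, σ c)) (hσ : σ.IsCycleOn Set.univ) (v : V) (c d : C) :
    Relation.EqvGen r (v, c) (v, d) := by
  obtain ⟨k, rfl⟩ := hσ.2 (Set.mem_univ c) (Set.mem_univ d)
  induction k using Int.induction_on with
  | zero => exact .refl _
  | succ n ih =>
    rw [add_comm, zpow_add, zpow_one, Equiv.Perm.mul_apply]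
    exact ih.trans _ _ _ (hr v _)
  | pred n ih =>
    refine ih.trans _ _ _ (Relation.EqvGen.symm _ _ ?_)
    have := hr v ((σ ^ (-(n : ℤ) - 1)) c)
    rwa [← Equiv.Perm.mul_apply, ← zpow_one_add, add_sub_cancel] at this

theorem jacket_numVertices [Nonempty C] (B : Bubble C V) {σ : Equiv.Perm C}
    (hσ : σ.IsCycleOn Set.univ) : (B.jacket σ ∅).numVertices = Nat.card V := by
  obtain ⟨c₀⟩ := ‹Nonempty C›
  refine Nat.card_congr ⟨Quot.lift Prod.fst ?_, fun v => Quot.mk _ (v, c₀), ?_, fun v => rfl⟩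
  · rintro ⟨v, c⟩ _ rfl
    rw [jacket_rot]
  · rintro ⟨v, c⟩
    refine Quot.eqvGen_sound (eqvGen_rot (fun v c => .rel _ _ ?_) hσ v c₀ c)
    rw [jacket_rot]

theorem jacket_numComponents [Nonempty C] (B : Bubble C V) {σ : Equiv.Perm C}
    (hσ : σ.IsCycleOn Set.univ) : (B.jacket σ ∅).numComponents = B.numComponents := by
  obtain ⟨c₀⟩ := ‹Nonempty C›
  have hrot : ∀ v c d, Relation.EqvGen
      (fun h h' => (B.jacket σ ∅).rot h = h' ∨ (B.jacket σ ∅).edge h = h') (v, c) (v, d) :=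
    eqvGen_rot (fun v c => .rel _ _ (Or.inl (B.jacket_rot σ v c))) hσ
  refine numClasses_eq_of_map Prod.fst (fun v => (v, c₀)) ?_ ?_ (fun _ => rfl) ?_
  · rintro ⟨v, c⟩ _ (rfl | rfl)
    · rw [jacket_rot]; exact .refl _
    · exact .rel _ _ ⟨c, rfl⟩
  · rintro v _ ⟨c, rfl⟩
    exact ((hrot v c₀ c).trans _ _ _ (.rel _ _ (Or.inr rfl))).trans _ _ _ (hrot _ c c₀)
  · rintro ⟨v, c⟩
    exact hrot v c₀ c

variable [Fintype C] [Finite V]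

theorem jacket_two_mul_numEdges (B : Bubble C V) (σ : Equiv.Perm C) :
    2 * (B.jacket σ ∅).numEdges = Nat.card V * Fintype.card C := by
  let E : Bubble Unit (V × C) :=
    { inv := fun _ => (B.jacket σ ∅).edge
      inv_inv := fun _ => (B.jacket σ ∅).edge_edge
      inv_ne := fun _ => (B.jacket σ ∅).edge_ne }
  have h := E.two_mul_numComps_singleton ()
  rw [Nat.card_prod, Nat.card_eq_fintype_card (α := C)] at h
  rw [← h]
  simp [numComps, RibbonGraph.numEdges, E]

/-- All the edges of the jacket are twisted and no vertex is filled, so the border follows the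
corner between the colors `c` and `σ c` along the cycles with these two colors. -/
theorem jacket_numFaces (B : Bubble C V) (σ : Equiv.Perm C) :
    (B.jacket σ ∅).numFaces = ∑ c, B.numFaces c (σ c) := by
  simp only [numFaces_eq]
  unfold numComps
  rw [← numClasses_sigma fun c v w => ∃ d ∈ ({c, σ c} : Set C), B.inv d v = w]
  have hcor : ∀ v c, (B.jacket σ ∅).Border ((v, c), true) ((v, σ c), false) := fun v c => by
    have := RibbonGraph.Border.corner (G := B.jacket σ ∅) (v, c)
    rwa [jacket_rot] at this
  have htw : ∀ v c s, (B.jacket σ ∅).Border ((v, c), s) ((B.inv c v, c), s) := fun v c s =>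
    .twisted (v, c) s (B.jacket_twisted σ _)
  refine numClasses_eq_of_map
    (fun x => (if x.2 then x.1.2 else σ.symm x.1.2, x.1.1)) (fun y => ((y.2, y.1), true))
    ?_ ?_ (fun _ => rfl) ?_
  · rintro _ _ (⟨v, c⟩ | ⟨_, _, h⟩ | ⟨⟨v, c⟩, s, -⟩)
    · rw [jacket_rot]
      simp only [if_true, Equiv.symm_apply_apply, Bool.false_eq_true, if_false]
      exact .refl _
    · exact absurd (B.jacket_twisted σ _) h
    · rw [jacket_edge]
      refine .rel _ _ ⟨rfl, c, ?_, rfl⟩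
      cases s <;> simp
  · rintro ⟨c, v⟩ ⟨d, w⟩ ⟨h, e, he, hw⟩
    dsimp only at h he hw ⊢
    subst h hw
    rcases he with rfl | rfl
    · exact .rel _ _ (htw v _ true)
    · exact ((Relation.EqvGen.rel _ _ (hcor v c)).trans _ _ _ (.rel _ _ (htw v (σ c) false))).trans
        _ _ _ (.symm _ _ (.rel _ _ (hcor _ c)))
  · rintro ⟨⟨v, c⟩, s⟩
    cases s
    · have := hcor v (σ.symm c)
      rw [Equiv.apply_symm_apply] at this
      exact .rel _ _ this
    · exact .refl _

theorem jacketGenus_eq [Nonempty C] (B : Bubble C V) {σ : Equiv.Perm C}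
    (hσ : σ.IsCycleOn Set.univ) :
    B.jacketGenus σ = B.numComponents + ((Fintype.card C : ℚ) - 2) * Nat.card V / 4
      - (∑ c, (B.numFaces c (σ c) : ℚ)) / 2 := by
  have h := B.jacket_two_mul_numEdges σ
  have h' : (2 : ℚ) * (B.jacket σ ∅).numEdges = Nat.card V * Fintype.card C := by exact_mod_cast h
  rw [jacketGenus, RibbonGraph.genus, B.jacket_numVertices hσ, B.jacket_numComponents hσ,
    B.jacket_numFaces σ]
  push_cast
  linarith

open Classical in
theorem degree_eq (h : 2 ≤ Fintype.card C) (B : Bubble C V) :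
    B.degree = (Fintype.card C - 1).factorial / 2 *
        (B.numComponents + ((Fintype.card C : ℚ) - 2) * Nat.card V / 4)
      - (Fintype.card C - 2).factorial / 4 *
        ∑ a, ∑ b, if a = b then 0 else (B.numFaces a b : ℚ) := by
  have : Nontrivial C := Fintype.one_lt_card_iff_nontrivial.1 h
  have e : B.degree = 1 / 2 * ∑ σ ∈ CyclicOrdering.fullCycles C, B.jacketGenus σ := by
    unfold degree CyclicOrdering.fullCycles
    congr!
  rw [e, Finset.sum_congr rfl fun σ hσ => B.jacketGenus_eq (CyclicOrdering.mem_fullCycles.1 hσ),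
    Finset.sum_sub_distrib, Finset.sum_const, CyclicOrdering.card_fullCycles h, ← Finset.sum_div,
    CyclicOrdering.sum_fullCycles h fun a b => (B.numFaces a b : ℚ), nsmul_eq_mul]
  ring

end Bubble

/-! ### The complete bubble -/

section completeBubble

theorem ZMod.exists_two_mul_eq {R : ℕ} (hR : Odd R) (x : ZMod R) : ∃ y : ZMod R, 2 * y = x := by
  have h2 : IsUnit ((2 : ℕ) : ZMod R) :=
    (ZMod.isUnit_iff_coprime 2 R).2 (Nat.coprime_two_left.2 hR)
  obtain ⟨y, hy⟩ := h2.dvd (a := x)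
  exact ⟨y, by rw [hy]; push_cast; ring⟩

variable {R : ℕ} (hR : Odd R)

theorem completeBubble_exists_inv_eq {x y : Option (ZMod R)} (hxy : x ≠ y) :
    ∃ c, (completeBubble R hR).inv c x = y := by
  rcases x with _ | n <;> rcases y with _ | m
  · exact absurd rfl hxy
  · exact ⟨m, rfl⟩
  · exact ⟨n, by simp [completeBubble]⟩
  · obtain ⟨c, hc⟩ := ZMod.exists_two_mul_eq hR (n + m)
    have hnc : n ≠ c := by
      rintro rfl
      exact hxy (by rw [show m = n by linear_combination -hc])
    refine ⟨c, ?_⟩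
    simp only [completeBubble, hnc, if_false]
    rw [hc]; congr 1; ring

/-- Two reflections of the polygon generate a rotation, and all rotations generate all the others
since `R` is prime: the edges of two distinct colors form a Hamiltonian cycle. -/
theorem completeBubble_eq_univ [Fact R.Prime] {i j : ZMod R} (hij : i ≠ j)
    {X : Set (Option (ZMod R))} (hX : X.Nonempty)
    (hi : ∀ u ∈ X, (completeBubble R hR).inv i u ∈ X)
    (hj : ∀ u ∈ X, (completeBubble R hR).inv j u ∈ X) : X = Set.univ := by
  have key : ∀ X : Set (Option (ZMod R)), X.Nonempty →
      (∀ u ∈ X, (completeBubble R hR).inv i u ∈ X) →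
      (∀ u ∈ X, (completeBubble R hR).inv j u ∈ X) → none ∈ X := by
    intro X ⟨u, hu⟩ hi hj
    by_contra hn
    rcases u with _ | n
    · exact hn hu
    have notin : ∀ k, (∀ u ∈ X, (completeBubble R hR).inv k u ∈ X) → ∀ n, some n ∈ X →
        n ≠ k ∧ some (2 * k - n) ∈ X := by
      intro k hk n hn'
      have hnk : n ≠ k := by
        rintro rfl
        exact hn (by simpa [completeBubble] using hk _ hn')
      exact ⟨hnk, by simpa [completeBubble, hnk] using hk _ hn'⟩
    have shift : ∀ (m : ℕ), some (n + m * (2 * (j - i))) ∈ X := by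
      intro m
      induction m with
      | zero => simpa using hu
      | succ m ih =>
        have := (notin j hj _ (notin i hi _ ih).2).2
        convert! this using 2
        push_cast; ring
    have h2 : (2 : ZMod R) ≠ 0 := by
      intro h
      have := ZMod.eq_of_two_mul_sub hR (i := i) (n := j)
        (by linear_combination (i - j) * h)
      exact hij this.symm
    have hd : 2 * (j - i) ≠ 0 := mul_ne_zero h2 (sub_ne_zero.2 hij.symm)
    have := shift ((i - n) / (2 * (j - i)) : ZMod R).val
    rw [ZMod.natCast_zmod_val, div_mul_cancel₀ _ hd, add_sub_cancel] at this
    exact (notin i hi _ this).1 rfl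
  by_contra hne
  have hc : ∀ k, (∀ u ∈ X, (completeBubble R hR).inv k u ∈ X) →
      ∀ u ∈ Xᶜ, (completeBubble R hR).inv k u ∈ Xᶜ := fun k hk u hu h =>
    hu (by simpa [(completeBubble R hR).inv_inv] using hk _ h)
  exact key Xᶜ (Set.nonempty_compl.2 hne) (hc i hi) (hc j hj) (key X hX hi hj)

end completeBubble

namespace Bubble

variable {C D V W I : Type}

theorem numComps_keep (B : Bubble C V) (f : D → C) (S : Set D) :
    (B.keep f).numComps S = B.numComps (f '' S) := by
  unfold numComps
  congr 1
  ext v w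
  simp [keep]

theorem numFaces_keep (B : Bubble C V) (f : D → C) (a b : D) :
    (B.keep f).numFaces a b = B.numFaces (f a) (f b) := by
  rw [numFaces_eq, numFaces_eq, numComps_keep, Set.image_pair]

theorem numFaces_comm (B : Bubble C V) (a b : C) : B.numFaces a b = B.numFaces b a := by
  rw [numFaces_eq, numFaces_eq, Set.pair_comm]

/-! ### Graphs whose interaction bubbles are complete -/

/-- The map `κ` indexes the interaction bubbles of `G`, i.e. the connected components after the
deletion of color `0`, by `I`. These have `|C| + 1` vertices, form complete graphs, and the edges
of any two colors form a Hamiltonian cycle in them. -/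
structure IsCopyIndex (G : Bubble (Option C) V) (κ : V → I) : Prop where
  inv : ∀ c u, κ (G.inv (some c) u) = κ u
  exists_inv : ∀ u w, κ u = κ w → u ≠ w → ∃ c, G.inv (some c) u = w
  connOn : ∀ i j, i ≠ j → ∀ u w, κ u = κ w → G.ConnOn {some i, some j} u w
  card : ∀ m, {u | κ u = m}.ncard = Nat.card C + 1

/-- A graph whose interaction bubbles are complete satisfies this condition if for every color `i`
the number of faces of colors `0`, `i` has the value `1 + n (|C| - 1) / 4`, where `n` is the number
of interaction bubbles. -/
def IsTight (G : Bubble (Option C) V) : Prop :=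
  ∀ i, 4 * G.numFaces none (some i) + G.deleteZero.numComponents =
    4 + Nat.card C * G.deleteZero.numComponents

/-- The deviation of the number of faces from its value in a tight graph. -/
noncomputable def faceExcess (G : Bubble (Option C) V) (i : C) : ℚ :=
  G.numFaces none (some i) - 1 - G.deleteZero.numComponents * ((Nat.card C : ℚ) - 1) / 4

theorem isTight_iff (G : Bubble (Option C) V) :
    G.IsTight ↔ ∀ i, G.faceExcess i = 0 := by
  refine forall_congr' fun i => ?_
  rw [faceExcess, ← Nat.cast_inj (R := ℚ)]
  push_cast
  constructor <;> intro h <;> linarith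

namespace IsCopyIndex

variable {G : Bubble (Option C) V} {κ : V → I}

theorem surjective (h : G.IsCopyIndex κ) : Function.Surjective κ := fun m => by
  have : {u | κ u = m}.ncard ≠ 0 := by rw [h.card]; omega
  obtain ⟨u, hu⟩ := Set.nonempty_of_ncard_ne_zero this
  exact ⟨u, hu⟩

theorem numComps_eq (h : G.IsCopyIndex κ) {S : Set (Option C)} (hS : none ∉ S) {i j : C}
    (hij : i ≠ j) (hi : some i ∈ S) (hj : some j ∈ S) : G.numComps S = Nat.card I := by
  have hκ : ∀ c ∈ S, ∀ u, κ (G.inv c u) = κ u := by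
    rintro (_ | c) hc u
    · exact absurd hc hS
    · exact h.inv c u
  refine Nat.card_congr (Equiv.ofBijective (Quot.lift κ ?_) ⟨?_, ?_⟩)
  · rintro u _ ⟨c, hc, rfl⟩
    exact (hκ c hc u).symm
  · rintro ⟨u⟩ ⟨w⟩ huw
    refine Quot.eqvGen_sound ((h.connOn i j hij u w huw).mono (T := S) ?_)
    rintro _ (rfl | rfl) <;> assumption
  · intro m
    obtain ⟨u, rfl⟩ := h.surjective m
    exact ⟨Quot.mk _ u, rfl⟩

theorem numComponents_deleteZero [Nontrivial C] (h : G.IsCopyIndex κ) :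
    G.deleteZero.numComponents = Nat.card I := by
  obtain ⟨i, j, hij⟩ := exists_pair_ne C
  rw [deleteZero, numComponents_keep]
  exact h.numComps_eq (by simp) hij (by simp) (by simp)

theorem numFaces_some [Nontrivial C] (h : G.IsCopyIndex κ) {i j : C} (hij : i ≠ j) :
    G.numFaces (some i) (some j) = G.deleteZero.numComponents := by
  rw [h.numComponents_deleteZero, numFaces_eq]
  exact h.numComps_eq (by simp) hij (by simp) (by simp)

theorem card_eq [Finite V] [Nontrivial C] (h : G.IsCopyIndex κ) :
    Nat.card V = (Nat.card C + 1) * G.deleteZero.numComponents := by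
  obtain ⟨i, j, hij⟩ := exists_pair_ne C
  rw [h.numComponents_deleteZero, ← h.numComps_eq (S := {some i, some j}) (by simp) hij
    (by simp) (by simp)]
  refine (mul_numClasses_eq _ _ fun a => ?_).symm
  rw [← h.card (κ a)]
  congr 1
  ext w
  refine ⟨fun hw => ?_, fun hw => h.connOn i j hij a w hw.symm⟩
  refine (ConnOn.map_eq (B := G) (S := {some i, some j}) κ hw ?_).symm
  rintro _ (rfl | rfl) u <;> exact h.inv _ u

theorem connOn_of_connected (h : G.IsCopyIndex κ) (hG : G.Connected) {i j : C}
    (hij : i ≠ j) (v w : V) : G.ConnOn {none, some i, some j} v w := by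
  rw [Connected, numComponents_eq, numComps_eq_one_iff] at hG
  refine (hG.2 v w).lift ?_
  rintro (_ | c) - u
  · exact connOn_inv (by simp) u
  · exact (h.connOn i j hij u _ (h.inv c u).symm).mono (by simp)

theorem numComps_eq_one (h : G.IsCopyIndex κ) (hG : G.Connected) {i j : C}
    (hij : i ≠ j) : G.numComps {none, some i, some j} = 1 := by
  have := h.connOn_of_connected hG hij
  rw [Connected, numComponents_eq, numComps_eq_one_iff] at hG
  exact (numComps_eq_one_iff _ _).2 ⟨hG.1, this⟩

variable [Finite V] [Nontrivial C]

theorem faceExcess_add_le (h : G.IsCopyIndex κ) (hG : G.Connected) {i j : C} (hij : i ≠ j) :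
    G.faceExcess i + G.faceExcess j ≤ 0 := by
  have H := (genusBound (f := none) (g := some i) (h := some j) (by simp) (by simp)
    (by simpa using hij) G).1
  rw [h.numComps_eq_one hG hij, ← numFaces_eq, ← numFaces_eq, ← numFaces_eq, h.numFaces_some hij,
    h.card_eq] at H
  have H' : (2 : ℚ) * (G.numFaces none (some i) + G.numFaces none (some j) +
      G.deleteZero.numComponents) ≤ 4 * 1 + (Nat.card C + 1) * G.deleteZero.numComponents := by
    exact_mod_cast H
  unfold faceExcess
  linarith

/-- In a tight graph all the graphs formed by three colors `0`, `i`, `j` are bipartite. -/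
theorem exists_isTwoColoring (h : G.IsCopyIndex κ) (hG : G.Connected) (hT : G.IsTight) {i j : C}
    (hij : i ≠ j) : ∃ s, G.IsTwoColoring {none, some i, some j} s := by
  refine (genusBound (f := none) (g := some i) (h := some j) (by simp) (by simp)
    (by simpa using hij) G).2 ?_
  rw [h.numComps_eq_one hG hij, ← numFaces_eq, ← numFaces_eq, ← numFaces_eq, h.numFaces_some hij,
    h.card_eq]
  have h1 := hT i
  have h2 := hT j
  rw [add_mul, one_mul]
  omega

theorem planarAt_iff (h : G.IsCopyIndex κ) (hG : G.Connected) {i j : C} (hij : i ≠ j) :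
    G.PlanarAt none (some i) (some j) ↔ G.faceExcess i + G.faceExcess j = 0 := by
  have hσ : (finRotate 3).IsCycleOn Set.univ := by
    have := (isCycle_finRotate (n := 1)).isCycleOn
    rwa [show {x | finRotate (1 + 2) x ≠ x} = Set.univ by
      ext x; fin_cases x <;> simp] at this
  rw [PlanarAt, jacketGenus_eq _ hσ, Fin.sum_univ_three]
  simp only [numFaces_keep, finRotate_apply, numComponents_keep]
  have e : Set.range ![none, some i, some j] = {none, some i, some j} := by
    ext x; simp; tauto
  rw [e, h.numComps_eq_one hG hij]
  have hV : (Nat.card V : ℚ) = (Nat.card C + 1) * G.deleteZero.numComponents := by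
    exact_mod_cast h.card_eq
  have hc := h.numFaces_some hij
  have h20 : G.numFaces (some j) none = G.numFaces none (some j) := numFaces_comm _ _ _
  unfold faceExcess
  simp [hV, hc, h20]
  constructor <;> intro H <;> linarith

theorem index_eq [Fintype C] (h : G.IsCopyIndex κ) (hG : G.Connected) :
    G.index = -((Fintype.card C - 1 : ℚ) / 2) * ∑ i, G.faceExcess i := by
  classical
  obtain ⟨m, hm⟩ := Nat.exists_eq_add_of_le (Fintype.one_lt_card : 1 < Fintype.card C)
  have hm' : Fintype.card C = m + 2 := by omega
  have hVn := h.card_eq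
  rw [Nat.card_eq_fintype_card (α := C), hm'] at hVn
  have hV : (Nat.card V : ℚ) = (m + 3) * G.deleteZero.numComponents := by
    rw [hVn]; push_cast; ring
  have hG' : G.numComponents = 1 := hG
  have hS : ∑ i : C, ∑ j : C, (if i = j then 0 else (G.numFaces (some i) (some j) : ℚ)) =
      (m + 2) * (m + 1) * G.deleteZero.numComponents := by
    have : ∀ i : C, ∑ j : C, (if i = j then 0 else (G.numFaces (some i) (some j) : ℚ)) =
        (m + 1) * G.deleteZero.numComponents := by
      intro i
      have e : ∀ j ∈ Finset.univ.erase i,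
          (if i = j then 0 else (G.numFaces (some i) (some j) : ℚ)) =
            G.deleteZero.numComponents := by
        intro j hj
        have := (Finset.ne_of_mem_erase hj).symm
        rw [if_neg this, h.numFaces_some this]
      rw [← Finset.add_sum_erase _ _ (Finset.mem_univ i), if_pos rfl, zero_add,
        Finset.sum_congr rfl e, Finset.sum_const, Finset.card_erase_of_mem (Finset.mem_univ i),
        Finset.card_univ, hm']
      simp
    rw [Finset.sum_congr rfl fun i _ => this i, Finset.sum_const, Finset.card_univ, hm']
    simp
    ring
  have hd1 := degree_eq (by rw [Fintype.card_option]; omega) G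
  have hd2 := degree_eq (by omega) G.deleteZero
  simp only [Fintype.sum_option, reduceCtorEq, if_false, Option.some.injEq, if_true, zero_add,
    Finset.sum_add_distrib, G.numFaces_comm (some _) none] at hd1
  simp only [deleteZero, numFaces_keep] at hd2
  rw [hS] at hd1
  rw [hS] at hd2
  rw [hG', hV, Fintype.card_option, hm', show m + 2 + 1 - 1 = m + 2 by omega,
    show m + 2 + 1 - 2 = m + 1 by omega, Nat.factorial_succ (m + 1), Nat.factorial_succ m] at hd1
  rw [hV, hm', show m + 2 - 1 = m + 1 by omega, show m + 2 - 2 = m by omega,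
    Nat.factorial_succ m] at hd2
  have hfac : (m.factorial : ℚ) ≠ 0 := by positivity
  unfold faceExcess
  rw [Finset.sum_sub_distrib, Finset.sum_sub_distrib, Finset.sum_const, Finset.sum_const,
    Finset.card_univ, Nat.card_eq_fintype_card, index, hd1]
  change _ * (_ - _ * (G.keep some).degree) = _
  rw [hd2, hm', show m + 2 - 2 = m by omega]
  simp only [deleteZero]
  push_cast
  rw [nsmul_eq_mul, nsmul_eq_mul]
  push_cast
  field_simp
  ring

end IsCopyIndex

end Bubble

open Bubble

section IsVacuumGraph

variable {R : ℕ} {hR : Odd R} {V I : Type}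

theorem isCopyIndex_of_equiv [Fact R.Prime] {G : Bubble (Option (ZMod R)) V}
    (e : V ≃ I × Option (ZMod R))
    (he : ∀ c v, e (G.inv (some c) v) = ((e v).1, (completeBubble R hR).inv c (e v).2)) :
    G.IsCopyIndex fun v => (e v).1 where
  inv c u := by rw [he]
  exists_inv u w huw hne := by
    obtain ⟨c, hc⟩ := completeBubble_exists_inv_eq hR (x := (e u).2) (y := (e w).2)
      fun h => hne (e.injective (Prod.ext huw h))
    exact ⟨c, e.injective (by rw [he, hc]; exact Prod.ext huw rfl)⟩
  connOn i j hij u w huw := by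
    have hu : e.symm ((e u).1, (e u).2) = u := e.symm_apply_apply u
    have hw : e.symm ((e u).1, (e w).2) = w := by rw [huw]; exact e.symm_apply_apply w
    have hX := completeBubble_eq_univ hR hij
      (X := {x | G.ConnOn {some i, some j} u (e.symm ((e u).1, x))})
      ⟨(e u).2, by change G.ConnOn _ _ _; rw [hu]; exact .refl u⟩
      (fun x hx => by
        change G.ConnOn _ _ _
        have := ConnOn.inv hx (c := some i) (by simp)
        rwa [← e.symm_apply_apply (G.inv (some i) _), he, e.apply_symm_apply] at this)
      (fun x hx => by
        change G.ConnOn _ _ _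
        have := ConnOn.inv hx (c := some j) (by simp)
        rwa [← e.symm_apply_apply (G.inv (some j) _), he, e.apply_symm_apply] at this)
    have : (e w).2 ∈ {x | G.ConnOn {some i, some j} u (e.symm ((e u).1, x))} :=
      hX ▸ Set.mem_univ _
    rw [← hw]; exact this
  card m := by
    have : {u | (e u).1 = m} = (fun x => e.symm (m, x)) '' Set.univ := by
      ext u
      constructor
      · rintro rfl
        exact ⟨(e u).2, trivial, e.symm_apply_apply u⟩
      · rintro ⟨x, -, rfl⟩
        simp
    rw [this, Set.ncard_image_of_injective _ fun x y hxy => by simpa using hxy, Set.ncard_univ,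
      Finite.card_option]

theorem IsVacuumGraph.exists_isCopyIndex [Fact R.Prime] {G : Bubble (Option (ZMod R)) V}
    (h : IsVacuumGraph hR G) : ∃ (n : ℕ) (κ : V → Fin n), G.IsCopyIndex κ := by
  obtain ⟨-, n, e, he⟩ := h
  exact ⟨n, _, isCopyIndex_of_equiv e he⟩

theorem IsVacuumGraph.finite [Fact R.Prime] {G : Bubble (Option (ZMod R)) V}
    (h : IsVacuumGraph hR G) : Finite V := by
  obtain ⟨-, n, e, he⟩ := h
  exact Finite.of_equiv _ e.symm

theorem IsVacuumGraph.of_isIso_copies [Finite I] {G : Bubble (Option (ZMod R)) V}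
    (hG : G.Connected) (h : G.deleteZero.IsIso ((completeBubble R hR).copies I)) :
    IsVacuumGraph hR G := by
  obtain ⟨n, ⟨f⟩⟩ := Finite.exists_equiv_fin I
  obtain ⟨e, he⟩ := h
  refine ⟨hG, n, e.trans (f.prodCongr (Equiv.refl _)), fun c v => ?_⟩
  simp [he, copies]

theorem powerOfN_eq [Fact R.Prime] {G : Bubble (Option (ZMod R)) V}
    (h : IsVacuumGraph hR G) : powerOfN G = R + ∑ i, G.faceExcess i := by
  obtain ⟨n, κ, hκ⟩ := h.exists_isCopyIndex
  have := h.finite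
  have hV : (Nat.card V : ℚ) = (R + 1) * G.deleteZero.numComponents := by
    have := hκ.card_eq
    rw [Nat.card_zmod] at this
    exact_mod_cast this
  unfold powerOfN faceExcess
  rw [Finset.sum_sub_distrib, Finset.sum_sub_distrib, Finset.sum_const, Finset.sum_const,
    Finset.card_univ, ZMod.card, Nat.card_zmod, hV, nsmul_eq_mul, nsmul_eq_mul]
  ring

end IsVacuumGraph

/-! ### Functions with nonpositive sums of pairs -/

section pairs

variable {C : Type} [Fintype C] {t : C → ℚ}

open Classical in
theorem sum_pairs (t : C → ℚ) :
    ∑ i, ∑ j, (if i = j then 0 else t i + t j) = 2 * ((Fintype.card C : ℚ) - 1) * ∑ i, t i := by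
  have e : ∀ i j, (if i = j then 0 else t i + t j) = t i + t j - if i = j then 2 * t i else 0 := by
    intro i j
    split_ifs with h
    · rw [h]; ring
    · ring
  simp only [e, Finset.sum_sub_distrib, Finset.sum_add_distrib, Finset.sum_const, Finset.card_univ,
    Finset.sum_ite_eq, Finset.mem_univ, if_true, nsmul_eq_mul, ← Finset.mul_sum]
  ring

theorem sum_nonpos_of_pairs (hC : 2 ≤ Fintype.card C) (ht : ∀ i j, i ≠ j → t i + t j ≤ 0) :
    ∑ i, t i ≤ 0 := by
  classical
  have h := sum_pairs t
  have h0 : ∑ i, ∑ j, (if i = j then 0 else t i + t j) ≤ 0 :=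
    Finset.sum_nonpos fun i _ => Finset.sum_nonpos fun j _ => by
      split_ifs with hij
      · rfl
      · exact ht i j hij
  have hc : (2 : ℚ) ≤ Fintype.card C := by exact_mod_cast hC
  by_contra! hpos
  have : 0 < 2 * ((Fintype.card C : ℚ) - 1) * ∑ i, t i := by
    have : (0 : ℚ) < Fintype.card C - 1 := by linarith
    positivity
  linarith

theorem eq_zero_of_pairs (hC : 3 ≤ Fintype.card C) (ht : ∀ i j, i ≠ j → t i + t j = 0) (i : C) :
    t i = 0 := by
  classical
  obtain ⟨j, hj⟩ : ∃ j, j ≠ i := by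
    have : Nontrivial C := Fintype.one_lt_card_iff_nontrivial.1 (by omega)
    exact exists_ne i
  obtain ⟨k, hk⟩ : ∃ k, k ∉ ({i, j} : Finset C) := by
    by_contra! h
    have h1 : Fintype.card C ≤ ({i, j} : Finset C).card := by
      rw [← Finset.card_univ]
      exact Finset.card_le_card fun x _ => h x
    have := Finset.card_le_two (a := i) (b := j)
    omega
  simp only [Finset.mem_insert, Finset.mem_singleton, not_or] at hk
  linarith [ht i j hj.symm, ht i k (Ne.symm hk.1), ht j k (Ne.symm hk.2)]

theorem pairs_eq_zero_of_sum (ht : ∀ i j, i ≠ j → t i + t j ≤ 0) (hs : ∑ i, t i = 0) (i j : C)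
    (hij : i ≠ j) : t i + t j = 0 := by
  classical
  have h := sum_pairs t
  rw [hs, mul_zero] at h
  have hle : ∀ i j, (if i = j then 0 else t i + t j) ≤ 0 := fun i j => by
    split_ifs with hij
    · rfl
    · exact ht i j hij
  rw [Finset.sum_eq_zero_iff_of_nonpos fun i _ => Finset.sum_nonpos fun j _ => hle i j] at h
  have h' := h i (Finset.mem_univ i)
  rw [Finset.sum_eq_zero_iff_of_nonpos fun j _ => hle i j] at h'
  simpa [hij] using h' j (Finset.mem_univ j)

end pairs

namespace Bubble

variable {C V V' W : Type}

/-! ### Isomorphisms -/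

theorem IsIso.numComps_eq {B : Bubble C V} {B' : Bubble C V'} (h : B.IsIso B') (S : Set C) :
    B.numComps S = B'.numComps S := by
  obtain ⟨e, he⟩ := h
  refine numClasses_eq_of_map e e.symm ?_ ?_ e.apply_symm_apply fun a => ?_
  · rintro a _ ⟨c, hc, rfl⟩
    exact .rel _ _ ⟨c, hc, (he c a).symm⟩
  · rintro a _ ⟨c, hc, rfl⟩
    exact .rel _ _ ⟨c, hc, by rw [← e.symm_apply_apply (B.inv c _), he, e.apply_symm_apply]⟩
  · rw [e.symm_apply_apply]; exact .refl a

theorem IsIso.symm {B : Bubble C V} {B' : Bubble C V'} (h : B.IsIso B') : B'.IsIso B := by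
  obtain ⟨e, he⟩ := h
  exact ⟨e.symm, fun c v => e.injective (by simp [he])⟩

theorem IsIso.trans {B : Bubble C V} {B' : Bubble C V'} {B'' : Bubble C W} (h : B.IsIso B')
    (h' : B'.IsIso B'') : B.IsIso B'' := by
  obtain ⟨e, he⟩ := h
  obtain ⟨e', he'⟩ := h'
  exact ⟨e.trans e', fun c v => by simp [he, he']⟩

theorem IsIso.keep {D : Type} {B : Bubble C V} {B' : Bubble C V'} (h : B.IsIso B') (f : D → C) :
    (B.keep f).IsIso (B'.keep f) := by
  obtain ⟨e, he⟩ := h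
  exact ⟨e, fun c v => he (f c) v⟩

theorem IsIso.connected {B : Bubble C V} {B' : Bubble C V'} (h : B.IsIso B')
    (hB : B.Connected) : B'.Connected := by
  rw [Connected, numComponents_eq] at hB ⊢
  rw [← h.numComps_eq, hB]

theorem IsIso.faceExcess_eq {B : Bubble (Option C) V} {B' : Bubble (Option C) V'}
    (h : B.IsIso B') (i : C) : B'.faceExcess i = B.faceExcess i := by
  have h' : B.deleteZero.IsIso B'.deleteZero := h.keep some
  unfold faceExcess
  rw [numFaces_eq, numFaces_eq, h.numComps_eq, numComponents_eq, numComponents_eq,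
    h'.numComps_eq]

/-! ### Insertions -/

/-- The disjoint union of two graphs. -/
def disjointUnion (B : Bubble C V) (B' : Bubble C W) : Bubble C (V ⊕ W) where
  inv c := Sum.map (B.inv c) (B'.inv c)
  inv_inv c z := by rcases z with x | y <;> simp [B.inv_inv, B'.inv_inv]
  inv_ne c z := by rcases z with x | y <;> simp [B.inv_ne, B'.inv_ne]

theorem not_connOn_disjointUnion (B : Bubble C V) (B' : Bubble C W) (S : Set C) (v : V) (w : W) :
    ¬ (B.disjointUnion B').ConnOn S (Sum.inl v) (Sum.inr w) := by
  intro h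
  have := h.map_eq Sum.isLeft (by rintro c - (x | y) <;> rfl)
  simp at this

theorem numComps_disjointUnion [Finite V] [Finite W] (B : Bubble C V) (B' : Bubble C W)
    (S : Set C) : (B.disjointUnion B').numComps S = B.numComps S + B'.numComps S := by
  have : Finite (Quot fun v w => ∃ c ∈ S, B.inv c v = w) := Quot.finite _
  have : Finite (Quot fun v w => ∃ c ∈ S, B'.inv c v = w) := Quot.finite _
  unfold numComps numClasses
  rw [← Nat.card_sum]
  refine Nat.card_congr
    ⟨Quot.lift (Sum.elim (fun v => Sum.inl (Quot.mk _ v)) (fun w => Sum.inr (Quot.mk _ w))) ?_,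
      Sum.elim (Quot.lift (fun v => Quot.mk _ (Sum.inl v)) ?_)
        (Quot.lift (fun w => Quot.mk _ (Sum.inr w)) ?_), ?_, ?_⟩
  · rintro (v | w) _ ⟨c, hc, rfl⟩
    · exact congrArg Sum.inl (Quot.sound ⟨c, hc, rfl⟩)
    · exact congrArg Sum.inr (Quot.sound ⟨c, hc, rfl⟩)
  · rintro v _ ⟨c, hc, rfl⟩
    exact Quot.sound ⟨c, hc, rfl⟩
  · rintro v _ ⟨c, hc, rfl⟩
    exact Quot.sound ⟨c, hc, rfl⟩
  · rintro ⟨v | w⟩ <;> rfl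
  · rintro (⟨⟨v⟩⟩ | ⟨⟨w⟩⟩) <;> rfl

theorem isSwitch_insertion (B : Bubble (Option C) V) (v : V) (B' : Bubble (Option C) W) (w : W) :
    IsSwitch (B.disjointUnion B') (B.insertion v B' w) none (Sum.inl v) (Sum.inr w) where
  ne := by simp
  inv_ne := by simp [disjointUnion]
  of_ne d hd := by
    rcases d with _ | i
    · exact absurd rfl hd
    · funext z
      rcases z with x | y <;> rfl
  left := by simp [insertion]
  right := by simp [insertion, disjointUnion, B.inv_ne]
  other u h1 h2 h3 h4 := by
    rcases u with x | y
    · simp only [disjointUnion, Sum.map_inl, ne_eq, Sum.inl.injEq] at h1 h3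
      simp [insertion, disjointUnion, h1, h3]
    · simp only [disjointUnion, Sum.map_inr, ne_eq, Sum.inr.injEq] at h2 h4
      simp [insertion, disjointUnion, h2, h4]

theorem deleteZero_insertion (B : Bubble (Option C) V) (v : V) (B' : Bubble (Option C) W) (w : W) :
    (B.insertion v B' w).deleteZero = B.deleteZero.disjointUnion B'.deleteZero := by
  have h : (B.insertion v B' w).deleteZero.inv = (B.deleteZero.disjointUnion B'.deleteZero).inv := by
    funext c z
    rcases z with x | y <;> rfl
  cases h1 : (B.insertion v B' w).deleteZero
  cases h2 : B.deleteZero.disjointUnion B'.deleteZero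
  simp_all

variable [Finite V] [Finite W]

/-- The cycles of colors `0`, `i` through the two edges that are cut open are merged. -/
theorem numComps_insertion_add_one (B : Bubble (Option C) V) (v : V) (B' : Bubble (Option C) W)
    (w : W) {S : Set (Option C)} (h0 : none ∈ S) {i : C} (hi : some i ∈ S) :
    (B.insertion v B' w).numComps S + 1 = B.numComps S + B'.numComps S := by
  have hs := B.isSwitch_insertion v B' w
  have h1 := B.not_connOn_disjointUnion B' S v w
  have h2 := (hs.conn_or_conn (g := some i) (by simp) h0 hi).resolve_left h1
  have h3 := hs.numComps_add h0
  rw [if_neg h1, if_pos h2, numComps_disjointUnion] at h3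
  omega

theorem faceExcess_insertion (B : Bubble (Option C) V) (v : V) (B' : Bubble (Option C) W) (w : W)
    (i : C) : (B.insertion v B' w).faceExcess i = B.faceExcess i + B'.faceExcess i := by
  have h := B.numComps_insertion_add_one v B' w (S := {none, some i}) (by simp) (i := i) (by simp)
  rw [← numFaces_eq, ← numFaces_eq, ← numFaces_eq] at h
  have h' : ((B.insertion v B' w).numFaces none (some i) : ℚ) + 1 =
      B.numFaces none (some i) + B'.numFaces none (some i) := by exact_mod_cast h
  unfold faceExcess
  rw [deleteZero_insertion, numComponents_eq, numComponents_eq, numComponents_eq,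
    numComps_disjointUnion]
  push_cast
  linarith

theorem connected_insertion_iff [Nonempty C] (B : Bubble (Option C) V) (v : V)
    (B' : Bubble (Option C) W) (w : W) :
    (B.insertion v B' w).Connected ↔ B.Connected ∧ B'.Connected := by
  obtain ⟨i⟩ := ‹Nonempty C›
  have h := B.numComps_insertion_add_one v B' w (S := Set.univ) (by simp) (i := i) (by simp)
  have : Nonempty V := ⟨v⟩
  have : Nonempty W := ⟨w⟩
  have h1 : 0 < B.numComps Set.univ := numClasses_pos _
  have h2 : 0 < B'.numComps Set.univ := numClasses_pos _
  rw [Connected, Connected, Connected, numComponents_eq, numComponents_eq, numComponents_eq]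
  omega

end Bubble

section mirror

variable {R : ℕ} {hR : Odd R} {V V' W : Type}

/-! ### Mirror melons are tight -/

theorem IsVacuumGraph.of_isIso {G : Bubble (Option (ZMod R)) V} {G' : Bubble (Option (ZMod R)) V'}
    (h : IsVacuumGraph hR G) (e : G.IsIso G') : IsVacuumGraph hR G' := by
  obtain ⟨h1, n, h2⟩ := h
  exact ⟨e.connected h1, n, (e.symm.keep some).trans h2⟩

variable [Fact R.Prime]

theorem IsVacuumGraph.insertion {G : Bubble (Option (ZMod R)) V} {G' : Bubble (Option (ZMod R)) W}
    (h : IsVacuumGraph hR G) (h' : IsVacuumGraph hR G') (v : V) (w : W) :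
    IsVacuumGraph hR (G.insertion v G' w) := by
  have := h.finite
  have := h'.finite
  obtain ⟨h1, n, e, he⟩ := h
  obtain ⟨h2, m, f, hf⟩ := h'
  refine .of_isIso_copies (I := Fin n ⊕ Fin m)
    ((G.connected_insertion_iff v G' w).2 ⟨h1, h2⟩) ?_
  rw [deleteZero_insertion]
  refine ⟨(e.sumCongr f).trans (Equiv.sumProdDistrib _ _ _).symm, ?_⟩
  rintro c (x | y)
  · simp [disjointUnion, he, copies]
  · simp [disjointUnion, hf, copies]

theorem isVacuumGraph_elementaryMirrorMelon :
    IsVacuumGraph hR (completeBubble R hR).elementaryMirrorMelon := by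
  refine .of_isIso_copies (I := Bool) ?_ ⟨Equiv.refl _, fun c v => rfl⟩
  have hκ := isCopyIndex_of_equiv (hR := hR) (G := (completeBubble R hR).elementaryMirrorMelon)
    (Equiv.refl _) fun c v => rfl
  rw [Connected, numComponents_eq, numComps_eq_one_iff]
  refine ⟨⟨(true, none)⟩, ?_⟩
  have h01 : (0 : ZMod R) ≠ 1 := zero_ne_one
  have hsame : ∀ b x y, (completeBubble R hR).elementaryMirrorMelon.ConnOn Set.univ (b, x) (b, y) :=
    fun b x y => (hκ.connOn 0 1 h01 (b, x) (b, y) rfl).mono (Set.subset_univ _)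
  have hflip : ∀ b x, (completeBubble R hR).elementaryMirrorMelon.ConnOn Set.univ (b, x) (!b, x) :=
    fun b x => .of_inv (c := none) (Set.mem_univ _) rfl
  rintro ⟨b, x⟩ ⟨b', y⟩
  by_cases hb : b' = b
  · subst hb; exact hsame _ x y
  · rw [Bool.eq_not.2 hb]
    exact (hsame b x y).trans (hflip b y)

/-- In the elementary mirror melon all the faces of colors `0`, `i` have four vertices. -/
theorem faceExcess_elementaryMirrorMelon (i : ZMod R) :
    (completeBubble R hR).elementaryMirrorMelon.faceExcess i = 0 := by
  have hκ := isCopyIndex_of_equiv (hR := hR) (G := (completeBubble R hR).elementaryMirrorMelon)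
    (Equiv.refl _) fun c v => rfl
  have h1 := hκ.numComponents_deleteZero
  have h2 : (completeBubble R hR).elementaryMirrorMelon.numComps {none, some i} =
      (completeBubble R hR).numComps {i} := by
    refine numClasses_eq_of_map Prod.snd (fun w => (true, w)) ?_ ?_ (fun _ => rfl) ?_
    · rintro ⟨b, x⟩ _ ⟨c, rfl | rfl, rfl⟩
      · exact .refl _
      · exact .rel _ _ ⟨i, rfl, rfl⟩
    · rintro x _ ⟨c, rfl, rfl⟩
      exact .rel _ _ ⟨some c, by simp, rfl⟩
    · rintro ⟨b, x⟩
      cases b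
      · exact .rel _ _ ⟨none, by simp, rfl⟩
      · exact .refl _
  have h3 := (completeBubble R hR).two_mul_numComps_singleton i
  rw [← h2, ← numFaces_eq, Finite.card_option, Nat.card_zmod] at h3
  have h4 : (2 : ℚ) * (completeBubble R hR).elementaryMirrorMelon.numFaces none (some i) = R + 1 := by
    exact_mod_cast h3
  unfold faceExcess
  rw [h1, Nat.card_zmod, Nat.card_eq_fintype_card, Fintype.card_bool]
  push_cast
  linarith

theorem Bubble.IsMirrorMelon.isVacuumGraph_and_faceExcess {G : Bubble (Option (ZMod R)) V}
    (h : (completeBubble R hR).IsMirrorMelon G) :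
    IsVacuumGraph hR G ∧ ∀ i, G.faceExcess i = 0 := by
  induction h with
  | elementary => exact ⟨isVacuumGraph_elementaryMirrorMelon, faceExcess_elementaryMirrorMelon⟩
  | insertion G v w _ ih =>
    have := ih.1.finite
    have := (isVacuumGraph_elementaryMirrorMelon (hR := hR)).finite
    refine ⟨ih.1.insertion isVacuumGraph_elementaryMirrorMelon v w, fun i => ?_⟩
    rw [faceExcess_insertion, ih.2, faceExcess_elementaryMirrorMelon, add_zero]
  | iso G G' _ e ih =>
    exact ⟨ih.1.of_isIso e, fun i => by rw [e.faceExcess_eq, ih.2]⟩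

end mirror

namespace Bubble

/-! ### Mirror melons are closed under insertions -/

section insertion

variable {C V V' W W' : Type}

theorem insertion_inv (G : Bubble (Option C) V) (v : V) (G' : Bubble (Option C) W) (w : W) :
    G.insertion (G.inv none v) G' (G'.inv none w) = G.insertion v G' w := by
  have h1 := (G.inv_ne none v).symm
  have h2 := (G'.inv_ne none w).symm
  have h : (G.insertion (G.inv none v) G' (G'.inv none w)).inv = (G.insertion v G' w).inv := by
    funext c z
    rcases c with _ | i <;> rcases z with x | y
    · by_cases a : x = v
      · simp [insertion, inv_inv, a, h1]
      · simp [insertion, inv_inv, a]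
    · by_cases a : y = w
      · simp [insertion, inv_inv, a, h2]
      · simp [insertion, inv_inv, a]
    · rfl
    · rfl
  cases e1 : G.insertion (G.inv none v) G' (G'.inv none w)
  cases e2 : G.insertion v G' w
  simp_all

theorem IsIso.insertion_right {G' : Bubble (Option C) W} {G'' : Bubble (Option C) W'}
    (h : G'.IsIso G'') (G : Bubble (Option C) V) (v : V) :
    ∃ e : W ≃ W', ∀ w, (G.insertion v G' w).IsIso (G.insertion v G'' (e w)) := by
  obtain ⟨e, he⟩ := h
  refine ⟨e, fun w => ⟨(Equiv.refl V).sumCongr e, ?_⟩⟩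
  rintro (_ | i) (x | y)
  · simp only [insertion, Equiv.sumCongr_apply, Sum.map_inl, Equiv.refl_apply]
    split_ifs <;> simp [he]
  · by_cases a : y = w
    · simp [insertion, a]
    by_cases b : y = G'.inv none w
    · simp [insertion, b, inv_ne, ← he]
    · simp [insertion, a, b, ← he]
  · rfl
  · simp [insertion, he]

/-- Insertion at an edge of `G₂` not cut open by the insertion of `E` in `G₂`. -/
theorem insertion_insertion_inl (G₁ : Bubble (Option C) V) (v : V) (G₂ : Bubble (Option C) V')
    (v' : V') (E : Bubble (Option C) W) (t : W) (u : V') (h : u ≠ v') (h' : u ≠ G₂.inv none v') :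
    (G₁.insertion v (G₂.insertion v' E t) (Sum.inl u)).IsIso
      ((G₁.insertion v G₂ u).insertion (Sum.inr v') E t) := by
  have j1 := fun x y => (G₁.inv_injective none).eq_iff (a := x) (b := y)
  have j2 := fun x y => (G₂.inv_injective none).eq_iff (a := x) (b := y)
  have j3 := fun x y => (E.inv_injective none).eq_iff (a := x) (b := y)
  have n1 := fun x => (G₁.inv_ne none x).symm
  have n2 := fun x => (G₂.inv_ne none x).symm
  have n3 := fun x => (E.inv_ne none x).symm
  have k : v' ≠ G₂.inv none u := fun e => h' (by rw [e, inv_inv])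
  refine ⟨(Equiv.sumAssoc _ _ _).symm, ?_⟩
  rintro (_ | i) (x | y | z)
  · by_cases c0 : x = v
    · simp [insertion, h, h', h.symm, k, c0]
    by_cases c1 : x = G₁.inv none v
    · simp [insertion, inv_ne, h, h', h.symm, k, c1]
    simp [insertion, h, h', h.symm, k, c0, c1]
  · by_cases c0 : y = u
    · simp [insertion, h, h', h.symm, k, c0]
    by_cases c1 : y = G₂.inv none u
    · simp [insertion, inv_ne, h, h', h.symm, k, k.symm, j2, c1]
    by_cases c2 : y = v'
    · simp [insertion, h, h', h.symm, k, c2]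
    by_cases c3 : y = G₂.inv none v'
    · simp [insertion, inv_ne, h, h', h.symm, h'.symm, k, j2, c3]
    simp [insertion, h, h', h.symm, k, c0, c1, c2, c3]
  · by_cases c0 : z = t
    · simp [insertion, h, h', h.symm, k, c0]
    by_cases c1 : z = E.inv none t
    · simp [insertion, inv_ne, h, h', h.symm, k, c1]
    simp [insertion, h, h', h.symm, k, c0, c1]
  · rfl
  · rfl
  · rfl

/-- Insertion at an edge of `E` not cut open by the insertion of `E` in `G₂`. -/
theorem insertion_insertion_inr (G₁ : Bubble (Option C) V) (v : V) (G₂ : Bubble (Option C) V')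
    (v' : V') (E : Bubble (Option C) W) (t : W) (s : W) (h : s ≠ t) (h' : s ≠ E.inv none t) :
    (G₁.insertion v (G₂.insertion v' E t) (Sum.inr s)).IsIso
      ((G₁.insertion v E s).insertion (Sum.inr t) G₂ v') := by
  have j1 := fun x y => (G₁.inv_injective none).eq_iff (a := x) (b := y)
  have j2 := fun x y => (G₂.inv_injective none).eq_iff (a := x) (b := y)
  have j3 := fun x y => (E.inv_injective none).eq_iff (a := x) (b := y)
  have n1 := fun x => (G₁.inv_ne none x).symm
  have n2 := fun x => (G₂.inv_ne none x).symm
  have n3 := fun x => (E.inv_ne none x).symm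
  have k : t ≠ E.inv none s := fun e => h' (by rw [e, inv_inv])
  refine ⟨((Equiv.refl V).sumCongr (Equiv.sumComm _ _)).trans (Equiv.sumAssoc _ _ _).symm, ?_⟩
  rintro (_ | i) (x | y | z)
  · by_cases c0 : x = v
    · simp [insertion, h, h', h.symm, k, c0]
    by_cases c1 : x = G₁.inv none v
    · simp [insertion, inv_ne, h, h', h.symm, k, c1]
    simp [insertion, h, h', h.symm, k, c0, c1]
  · by_cases c0 : y = v'
    · simp [insertion, h, h', h.symm, k, c0]
    by_cases c1 : y = G₂.inv none v'
    · simp [insertion, inv_ne, h, h', h.symm, k, c1]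
    simp [insertion, h, h', h.symm, k, c0, c1]
  · by_cases c0 : z = s
    · simp [insertion, h, h', h.symm, k, c0]
    by_cases c1 : z = E.inv none s
    · simp [insertion, inv_ne, h, h', h.symm, k, k.symm, j3, c1]
    by_cases c2 : z = t
    · simp [insertion, h, h', h.symm, k, c2]
    by_cases c3 : z = E.inv none t
    · simp [insertion, inv_ne, h, h', h.symm, h'.symm, k, j3, c3]
    simp [insertion, h, h', h.symm, k, c0, c1, c2, c3]
  · rfl
  · rfl
  · rfl

/-- Insertion at one of the two edges created by the insertion of `E` in `G₂`. -/
theorem insertion_insertion_self (G₁ : Bubble (Option C) V) (v : V) (G₂ : Bubble (Option C) V')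
    (v' : V') (E : Bubble (Option C) W) (t : W) :
    (G₁.insertion v (G₂.insertion v' E t) (Sum.inl v')).IsIso
      ((G₁.insertion v G₂ v').insertion (Sum.inl (G₁.inv none v)) E t) := by
  have j1 := fun x y => (G₁.inv_injective none).eq_iff (a := x) (b := y)
  have j2 := fun x y => (G₂.inv_injective none).eq_iff (a := x) (b := y)
  have j3 := fun x y => (E.inv_injective none).eq_iff (a := x) (b := y)
  have n1 := fun x => (G₁.inv_ne none x).symm
  have n2 := fun x => (G₂.inv_ne none x).symm
  have n3 := fun x => (E.inv_ne none x).symm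
  refine ⟨(Equiv.sumAssoc _ _ _).symm, ?_⟩
  rintro (_ | i) (x | y | z)
  · by_cases c0 : x = v
    · simp [insertion, inv_ne, n1, n2, c0]
    by_cases c1 : x = G₁.inv none v
    · simp [insertion, inv_ne, n2, c1]
    simp [insertion, inv_ne, c0, c1]
  · by_cases c0 : y = v'
    · simp [insertion, inv_ne, n2, c0]
    by_cases c1 : y = G₂.inv none v'
    · simp [insertion, inv_ne, n2, c1]
    simp [insertion, inv_ne, c0, c1]
  · by_cases c0 : z = t
    · simp [insertion, inv_ne, n2, c0]
    by_cases c1 : z = E.inv none t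
    · simp [insertion, inv_ne, n2, c1]
    simp [insertion, inv_ne, c0, c1]
  · rfl
  · rfl
  · rfl

end insertion

theorem IsMirrorMelon.insertion_of_isMirrorMelon {C V V' W : Type} {K : Bubble C W}
    {G₁ : Bubble (Option C) V} {G₂ : Bubble (Option C) V'} (h₂ : K.IsMirrorMelon G₂)
    (h₁ : K.IsMirrorMelon G₁) (v : V) (w : V') : K.IsMirrorMelon (G₁.insertion v G₂ w) := by
  induction h₂ generalizing V with
  | elementary => exact .insertion G₁ v w h₁
  | iso G G' _ e ih =>
    obtain ⟨f, hf⟩ := e.insertion_right G₁ v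
    have := hf (f.symm w)
    rw [f.apply_symm_apply] at this
    exact .iso _ _ (ih h₁ v (f.symm w)) this
  | insertion G v' t _ ih =>
    have self : ∀ v v' t, K.IsMirrorMelon
        (G₁.insertion v (G.insertion v' K.elementaryMirrorMelon t) (Sum.inl v')) :=
      fun v v' t => .iso _ _ (.insertion _ (Sum.inl (G₁.inv none v)) t (ih h₁ v v'))
        (G₁.insertion_insertion_self v G v' K.elementaryMirrorMelon t).symm
    -- By `insertion_inv` the end `inr t` of a new edge can be exchanged with its other end `inl v'`.
    have self' : ∀ v v' t, K.IsMirrorMelon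
        (G₁.insertion v (G.insertion v' K.elementaryMirrorMelon t) (Sum.inr t)) := by
      intro v v' t
      rw [← insertion_inv G₁]
      have : (G.insertion v' K.elementaryMirrorMelon t).inv none (Sum.inr t) = Sum.inl v' := by
        simp [Bubble.insertion]
      rw [this]
      exact self _ _ _
    rcases w with u | s
    · by_cases hu : u = v'
      · subst hu; exact self v u t
      by_cases hu' : u = G.inv none v'
      · rw [← insertion_inv G v', ← hu']; exact self v u _
      exact .iso _ _ (.insertion _ (Sum.inr v') t (ih h₁ v u))
        (G₁.insertion_insertion_inl v G v' K.elementaryMirrorMelon t u hu hu').symm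
    · by_cases hs : s = t
      · subst hs; exact self' v v' s
      by_cases hs' : s = K.elementaryMirrorMelon.inv none t
      · rw [← insertion_inv G v', ← hs']; exact self' v _ s
      exact .iso _ _ (ih (.insertion G₁ v s h₁) (Sum.inr t) v')
        (G₁.insertion_insertion_inr v G v' K.elementaryMirrorMelon t s hs hs').symm

end Bubble

namespace Bubble

namespace IsCopyIndex

variable {C V I : Type} [Finite V] {G : Bubble (Option C) V} {κ : V → I}

/-! ### Local structure of tight graphs -/

theorem exists_third (h : G.IsCopyIndex κ) (hC : 2 ≤ Nat.card C) (x y : V) :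
    ∃ z, κ z = κ x ∧ z ≠ x ∧ z ≠ y := by
  have h2 : ({x, y} : Set V).ncard < {u | κ u = κ x}.ncard := by
    rw [h.card]
    exact (Set.ncard_insert_le x {y}).trans_lt (by rw [Set.ncard_singleton]; omega)
  obtain ⟨z, hz, hz'⟩ := Set.exists_mem_notMem_of_ncard_lt_ncard h2
  simp only [Set.mem_insert_iff, Set.mem_singleton_iff, not_or] at hz'
  exact ⟨z, hz, hz'⟩

theorem inv_ne_inv (h : G.IsCopyIndex κ) (hC : 2 ≤ Nat.card C) {i j : C} (hij : i ≠ j) (u : V) :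
    G.inv (some i) u ≠ G.inv (some j) u := by
  intro e
  obtain ⟨z, hz, h1, h2⟩ := h.exists_third hC u (G.inv (some i) u)
  have := ((h.connOn i j hij u z hz.symm).mem_iff (X := {u, G.inv (some i) u}) (by
    rintro _ (rfl | rfl) v (rfl | rfl)
    · simp
    · simp [G.inv_inv]
    · simp [e]
    · rw [e, G.inv_inv]; simp)).1 (by simp)
  rcases this with rfl | rfl
  · exact h1 rfl
  · exact h2 rfl

/-- No edge of color `0` joins two vertices of the same interaction bubble: both would be neighbors
of a third vertex of the bubble, in contradiction to bipartiteness. -/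
theorem map_inv_none_ne (h : G.IsCopyIndex κ) (hG : G.Connected) (hT : G.IsTight)
    (hC : 2 ≤ Nat.card C) (u : V) : κ (G.inv none u) ≠ κ u := by
  have : Finite C := Nat.finite_of_card_ne_zero (by omega)
  have : Nontrivial C := Finite.one_lt_card_iff_nontrivial.1 hC
  intro e
  obtain ⟨z, hz, h1, h2⟩ := h.exists_third hC u (G.inv none u)
  obtain ⟨i, hi⟩ := h.exists_inv u z hz.symm h1.symm
  obtain ⟨j, hj⟩ := h.exists_inv z (G.inv none u) (hz.trans e.symm) h2
  have hij : i ≠ j := by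
    rintro rfl
    rw [← hi, G.inv_inv] at hj
    exact G.inv_ne none u hj.symm
  obtain ⟨s, hs⟩ := h.exists_isTwoColoring hG hT hij
  have e0 := hs none (by simp) u
  have e1 := hs (some i) (by simp) u
  have e2 := hs (some j) (by simp) z
  rw [hj] at e2
  rw [hi] at e1
  rw [e2, e1] at e0
  simp at e0

theorem inv_none_ne_inv_some (h : G.IsCopyIndex κ) (hG : G.Connected) (hT : G.IsTight)
    (hC : 2 ≤ Nat.card C) (i : C) (u : V) : G.inv none u ≠ G.inv (some i) u := fun e =>
  h.map_inv_none_ne hG hT hC u (by rw [e, h.inv])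

/-- For three colors no face of colors `0`, `i` passes through three interaction bubbles. In the
two-coloring for `0` and the other two colors `j`, `k` the edges of color `i` join vertices of the
same type, so the number of edges of color `0` in the face is even. -/
theorem not_length_three (h : G.IsCopyIndex κ) (hG : G.Connected) (hT : G.IsTight)
    (hC : Nat.card C = 3) (i : C) (u : V) :
    G.inv none (G.inv (some i) (G.inv none u)) ≠
      G.inv (some i) (G.inv none (G.inv (some i) u)) := by
  classical
  have : Finite C := Nat.finite_of_card_ne_zero (by omega)
  have : Nontrivial C := Finite.one_lt_card_iff_nontrivial.1 (by omega)
  have := Fintype.ofFinite C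
  obtain ⟨j, hj⟩ := exists_ne i
  obtain ⟨k, hk, hall⟩ : ∃ k, k ≠ j ∧ ∀ c, c = i ∨ c = j ∨ c = k := by
    have h2 : (Finset.univ \ {i, j} : Finset C).card = 1 := by
      rw [Finset.card_sdiff_of_subset (Finset.subset_univ _), Finset.card_univ,
        ← Nat.card_eq_fintype_card, hC, Finset.card_pair hj.symm]
    obtain ⟨k, hk⟩ := Finset.card_eq_one.1 h2
    refine ⟨k, ?_, fun c => ?_⟩
    · have : k ∈ Finset.univ \ {i, j} := hk ▸ Finset.mem_singleton_self k
      simp at this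
      exact this.2
    · by_contra! hc
      have : c ∈ (Finset.univ \ {i, j} : Finset C) := by simp [hc.1, hc.2.1]
      rw [hk] at this
      exact hc.2.2 (Finset.mem_singleton.1 this)
  obtain ⟨s, hs⟩ := h.exists_isTwoColoring hG hT hk.symm
  have hsi : ∀ u, s (G.inv (some i) u) = s u := by
    intro u
    obtain ⟨c, hc⟩ := h.exists_inv (G.inv (some j) u) (G.inv (some i) u)
      (by rw [h.inv, h.inv]) (h.inv_ne_inv (by omega) hj u)
    rcases hall c with rfl | rfl | rfl
    · exact absurd (G.inv_injective _ hc) (G.inv_ne _ _)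
    · rw [G.inv_inv] at hc
      exact absurd hc.symm (G.inv_ne _ _)
    · rw [← hc, hs _ (by simp), hs _ (by simp), Bool.not_not]
  intro e
  have := congrArg s e
  rw [hs none (by simp), hsi, hs none (by simp), hsi, hs none (by simp), hsi, Bool.not_not] at this
  simp at this

/-- Some face has length two. Otherwise the faces would be too long, hence too few, for the
graph to be tight. -/
theorem exists_length_two (h : G.IsCopyIndex κ) (hG : G.Connected) (hT : G.IsTight)
    (hC : Nat.card C = 3 ∨ 5 ≤ Nat.card C) :
    ∃ i x, G.inv none (G.inv (some i) x) = G.inv (some i) (G.inv none x) := by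
  classical
  have : Finite C := Nat.finite_of_card_ne_zero (by omega)
  have : Nontrivial C := Finite.one_lt_card_iff_nontrivial.1 (by omega)
  by_contra! hn
  obtain ⟨i⟩ : Nonempty C := inferInstance
  have n1 := h.inv_none_ne_inv_some hG hT (by omega) i
  have n2 := G.inv_ne none
  have n3 := G.inv_ne (some i)
  have k2 := G.inv_inv none
  have k3 := G.inv_inv (some i)
  have n4 := hn i
  have hTi := hT i
  have hV := h.card_eq
  have c0 : none ∈ ({none, some i} : Set (Option C)) := by simp
  have ci : some i ∈ ({none, some i} : Set (Option C)) := by simp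
  have conn : ∀ x, ∀ X : Finset V, (∀ u ∈ X, G.ConnOn {none, some i} x u) →
      X.card ≤ {u | G.ConnOn {none, some i} x u}.ncard := fun x X hX => by
    rw [← Set.ncard_coe_finset]
    exact Set.ncard_le_ncard hX
  rw [numFaces_eq] at hTi
  rcases hC with hC | hC
  · have n5 := h.not_length_three hG hT hC i
    have : 8 * G.numComps {none, some i} ≤ Nat.card V := by
      refine mul_numClasses_le _ 8 fun x => ?_
      refine le_trans (le_of_eq ?_) (conn x
        {x, G.inv (some i) x, G.inv none (G.inv (some i) x),
          G.inv (some i) (G.inv none (G.inv (some i) x)),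
          G.inv none (G.inv (some i) (G.inv none (G.inv (some i) x))),
          G.inv none x, G.inv (some i) (G.inv none x),
          G.inv none (G.inv (some i) (G.inv none x))} ?_)
      · symm
        repeat rw [Finset.card_insert_of_notMem]
        · simp
        all_goals
          simp only [Finset.mem_insert, Finset.mem_singleton, not_or]
          grind
      · have hx := ConnOn.refl (B := G) (S := {none, some i}) x
        simp only [Finset.mem_insert, Finset.mem_singleton, forall_eq_or_imp, forall_eq]
        exact ⟨hx, hx.inv ci, (hx.inv ci).inv c0, ((hx.inv ci).inv c0).inv ci,
          (((hx.inv ci).inv c0).inv ci).inv c0, hx.inv c0, (hx.inv c0).inv ci,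
          ((hx.inv c0).inv ci).inv c0⟩
    rw [hC] at hTi hV
    omega
  · have : 6 * G.numComps {none, some i} ≤ Nat.card V := by
      refine mul_numClasses_le _ 6 fun x => ?_
      refine le_trans (le_of_eq ?_) (conn x
        {x, G.inv (some i) x, G.inv none (G.inv (some i) x),
          G.inv (some i) (G.inv none (G.inv (some i) x)),
          G.inv none x, G.inv (some i) (G.inv none x)} ?_)
      · symm
        repeat rw [Finset.card_insert_of_notMem]
        · simp
        all_goals
          simp only [Finset.mem_insert, Finset.mem_singleton, not_or]
          grind
      · have hx := ConnOn.refl (B := G) (S := {none, some i}) x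
        simp only [Finset.mem_insert, Finset.mem_singleton, forall_eq_or_imp, forall_eq]
        exact ⟨hx, hx.inv ci, (hx.inv ci).inv c0, ((hx.inv ci).inv c0).inv ci,
          hx.inv c0, (hx.inv c0).inv ci⟩
    have h5 := Nat.mul_le_mul_right G.deleteZero.numComponents hC
    rw [add_mul, one_mul] at hV
    omega

/-- Let `x`, `y = i x` be the two vertices, in an interaction bubble `a`, of a face of length two,
and let `z` be a third vertex of `a`. The edges from `x` and `y` to `z`, of colors `j` and `k`,
can be switched with the edges of the same colors at the other two vertices `x'`, `y'` of the face.
This increases the numbers of faces of colors `0`, `j` and `0`, `k`, so that the graph with colors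
`0`, `j`, `k` becomes disconnected: `z` is separated from the other vertices of `a`. -/
theorem exists_separating_set (h : G.IsCopyIndex κ) (hG : G.Connected) (hT : G.IsTight)
    (hC : 2 ≤ Nat.card C) {i : C} {x z : V}
    (hx : G.inv none (G.inv (some i) x) = G.inv (some i) (G.inv none x))
    (hz : κ z = κ x) (hzx : z ≠ x) (hzy : z ≠ G.inv (some i) x) :
    ∃ S : Set V, z ∈ S ∧ (∀ u ∈ S, G.inv none u ∈ S) ∧
      (∀ u ∈ S, κ u ≠ κ x → κ u ≠ κ (G.inv none x) → ∀ w, κ w = κ u → w ∈ S) ∧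
      (∀ u ∈ S, κ u = κ x → u = z) ∧
      G.inv none x ∉ S ∧ G.inv (some i) (G.inv none x) ∉ S := by
  have : Finite C := Nat.finite_of_card_ne_zero (by omega)
  have : Nontrivial C := Finite.one_lt_card_iff_nontrivial.1 hC
  obtain ⟨y, hy⟩ : ∃ y, y = G.inv (some i) x := ⟨_, rfl⟩
  obtain ⟨x', hx'⟩ : ∃ x', x' = G.inv none x := ⟨_, rfl⟩
  obtain ⟨y', hy'⟩ : ∃ y', y' = G.inv (some i) x' := ⟨_, rfl⟩
  have hyy' : G.inv none y = y' := by rw [hy, hy', hx', hx]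
  rw [← hx', ← hy']
  rw [← hy] at hzy
  have κy : κ y = κ x := by rw [hy, h.inv]
  have κy' : κ y' = κ x' := by rw [hy', h.inv]
  have κx' : κ x' ≠ κ x := by rw [hx']; exact h.map_inv_none_ne hG hT hC x
  have hyx : y ≠ x := by rw [hy]; exact G.inv_ne _ _
  obtain ⟨j, hj⟩ := h.exists_inv x z hz.symm hzx.symm
  obtain ⟨k, hk⟩ := h.exists_inv y z (κy.trans hz.symm) hzy.symm
  have hjz : G.inv (some j) z = x := by rw [← hj, G.inv_inv]
  have hkz : G.inv (some k) z = y := by rw [← hk, G.inv_inv]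
  have hjk : j ≠ k := by
    rintro rfl
    exact hyx (hkz.symm.trans hjz)
  have hsjk : (some j : Option C) ≠ some k := by simpa using hjk
  -- Vertices of different interaction bubbles are distinct.
  have ne_of_κ : ∀ {u w : V}, κ u ≠ κ w → u ≠ w := fun hκ e => hκ (congrArg κ e)
  obtain ⟨H₁, s₁⟩ := G.exists_isSwitch (some j) (p := x) (q := x') (ne_of_κ κx'.symm)
    (by rw [hj]; exact ne_of_κ (by rw [hz]; exact κx'.symm))
  have k₁ : H₁.inv (some k) = G.inv (some k) := s₁.of_ne _ hsjk.symm
  have o₁ : H₁.inv none = G.inv none := s₁.of_ne _ (by simp)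
  obtain ⟨H₂, s₂⟩ := H₁.exists_isSwitch (some k) (p := y) (q := y')
    (ne_of_κ (by rw [κy, κy']; exact κx'.symm))
    (by rw [k₁, hk]; exact ne_of_κ (by rw [hz, κy']; exact κx'.symm))
  have j₂ : H₂.inv (some j) = H₁.inv (some j) := s₂.of_ne _ hsjk
  have o₂ : H₂.inv none = G.inv none := (s₂.of_ne _ (by simp)).trans o₁
  -- The faces of colors `0`, `j` and `0`, `k`.
  have N0j : H₂.numComps {none, some j} = G.numComps {none, some j} + 1 := by
    rw [s₂.numComps_of_notMem (by simp [hjk.symm])]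
    have := s₁.numComps_add (S := {none, some j}) (by simp)
    have hcon : G.ConnOn {none, some j} x x' := .of_inv (c := none) (by simp) hx'.symm
    rw [if_pos hcon, if_neg] at this
    · omega
    · intro hc
      have := (hc.mem_iff (X := {x, x'}) (by
        rintro d (rfl | rfl) u (rfl | rfl)
        · rw [o₁]; simp [hx']
        · rw [o₁, hx', G.inv_inv]; simp
        · rw [s₁.left]; simp
        · rw [s₁.left']; simp)).1 (by simp)
      rw [hj] at this
      rcases this with e | e
      · exact hzx e
      · exact κx' (by rw [← e, hz])
  have N0k : H₂.numComps {none, some k} = G.numComps {none, some k} + 1 := by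
    rw [← s₁.numComps_of_notMem (S := {none, some k}) (by simp [hjk])]
    have := s₂.numComps_add (S := {none, some k}) (by simp)
    have hcon : H₁.ConnOn {none, some k} y y' := .of_inv (c := none) (by simp) (by rw [o₁, hyy'])
    rw [if_pos hcon, if_neg] at this
    · omega
    · intro hc
      have := (hc.mem_iff (X := {y, y'}) (by
        rintro d (rfl | rfl) u (rfl | rfl)
        · rw [o₂]; simp [hyy']
        · rw [o₂, ← hyy', G.inv_inv]; simp
        · rw [s₂.left]; simp
        · rw [s₂.left']; simp)).1 (by simp)
      rw [k₁, hk] at this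
      rcases this with e | e
      · exact hzy e
      · exact κx' (by rw [← κy', ← e, hz])
  -- The first switch joins the two cycles of colors `j`, `k`.
  have hxx' : ¬ G.ConnOn {some j, some k} x x' := by
    intro hc
    refine κx' (hc.map_eq κ ?_).symm
    rintro _ (rfl | rfl) u <;> exact h.inv _ u
  have c₁ : H₁.ConnOn {some j, some k} x (G.inv (some j) x) :=
    (s₁.conn_or_conn hsjk.symm (by simp) (by simp)).resolve_left hxx'
  have hyy₁ : H₁.ConnOn {some j, some k} y y' := by
    have e1 := s₁.conn_mono (by simp) c₁ (h.connOn j k hjk y x κy)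
    have e2 := s₁.conn_mono (by simp) c₁ (h.connOn j k hjk x' y' κy'.symm)
    exact (e1.trans (.of_inv (by simp) s₁.left)).trans e2
  have Njk : G.numComps {some j, some k} ≤ H₂.numComps {some j, some k} + 1 := by
    have e1 := s₁.numComps_add (S := {some j, some k}) (by simp)
    have e2 := s₂.numComps_add (S := {some j, some k}) (by simp)
    rw [if_pos c₁, if_neg hxx'] at e1
    rw [if_pos hyy₁] at e2
    omega
  -- Hence the genus inequality requires two components.
  have hcomp : H₂.numComps {none, some j, some k} ≠ 1 := by
    intro e
    have H := (genusBound (f := none) (g := some j) (h := some k) (by simp) (by simp)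
      hsjk H₂).1
    have e3 := h.numFaces_some hjk
    have e4 := hT j
    have e5 := hT k
    rw [numFaces_eq] at e3 e4 e5
    rw [e, N0j, N0k, h.card_eq, add_mul, one_mul] at H
    omega
  have hyz : ¬ H₂.ConnOn {none, some j, some k} y z := by
    intro hc
    refine hcomp ?_
    rw [numComps_eq_one_iff]
    refine ⟨⟨x⟩, fun v w => s₂.conn_mono (by simp) ?_ (s₁.conn_mono (by simp) (c₁.mono (by simp))
      (h.connOn_of_connected hG hjk v w))⟩
    rw [k₁, hk]; exact hc
  have oS : ∀ u, H₂.ConnOn {none, some j, some k} z u →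
      H₂.ConnOn {none, some j, some k} z (G.inv none u) := fun u hu => by
    rw [← o₂]; exact hu.inv (by simp)
  have hyS : ¬ H₂.ConnOn {none, some j, some k} z y := fun hc => hyz hc.symm
  have hy'S : ¬ H₂.ConnOn {none, some j, some k} z y' := fun hc => hyS (by
    have := oS _ hc
    rwa [← hyy', G.inv_inv] at this)
  have jeq : ∀ u, u ≠ x → u ≠ x' → u ≠ z → u ≠ G.inv (some j) x' →
      H₂.inv (some j) u = G.inv (some j) u := fun u h1 h2 h3 h4 => by
    rw [j₂]; exact s₁.other u h1 h2 (by rwa [hj]) h4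
  have keq : ∀ u, u ≠ y → u ≠ y' → u ≠ z → u ≠ G.inv (some k) y' →
      H₂.inv (some k) u = G.inv (some k) u := fun u h1 h2 h3 h4 => by
    rw [← k₁]; exact s₂.other u h1 h2 (by rwa [k₁, hk]) (by rwa [k₁])
  -- The other vertices of `a` in the component of `z` form a set closed under color `k`, and also
  -- under color `j`, up to the point `x`.
  let U : Set V := {u | H₂.ConnOn {none, some j, some k} z u ∧ κ u = κ x ∧ u ≠ z}
  have Uk : ∀ u ∈ U, G.inv (some k) u ∈ U := by
    rintro u ⟨h1, h2, h3⟩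
    have hu : u ≠ y := fun e => hyS (e ▸ h1)
    refine ⟨?_, by rw [h.inv, h2], fun e => hu (by rw [G.inv_eq_iff, hkz] at e; exact e)⟩
    rw [← keq u hu (ne_of_κ (by rw [h2, κy']; exact κx'.symm)) h3
      (ne_of_κ (by rw [h2, h.inv, κy']; exact κx'.symm))]
    exact h1.inv (by simp)
  have Uj : ∀ u ∈ U, u ≠ x → G.inv (some j) u ∈ U ∧ G.inv (some j) u ≠ x := by
    rintro u ⟨h1, h2, h3⟩ hu
    refine ⟨⟨?_, by rw [h.inv, h2], fun e => hu (by rw [G.inv_eq_iff, hjz] at e; exact e)⟩,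
      fun e => h3 (by rw [G.inv_eq_iff, hj] at e; exact e)⟩
    rw [← jeq u hu (ne_of_κ (by rw [h2]; exact κx'.symm)) h3
      (ne_of_κ (by rw [h2, h.inv]; exact κx'.symm))]
    exact h1.inv (by simp)
  have xU : x ∉ U := fun hxU => G.not_closed_of_closed G (some k) (some j) U x hxU Uk Uj
  have hxS : ¬ H₂.ConnOn {none, some j, some k} z x := fun hc => xU ⟨hc, rfl, hzx.symm⟩
  have U0 : ∀ u, u ∉ U := by
    intro u hu
    refine xU (((h.connOn j k hjk u x hu.2.1).mem_iff (X := U) ?_).1 hu)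
    rintro _ (rfl | rfl) w hw
    · exact (Uj w hw fun e => xU (e ▸ hw)).1
    · exact Uk w hw
  refine ⟨{u | H₂.ConnOn {none, some j, some k} z u}, .refl z, oS, ?_, ?_, ?_, hy'S⟩
  · intro u hu h1 h2 w hw
    have := ((h.connOn j k hjk u w hw.symm).mem_iff
      (X := {u | H₂.ConnOn {none, some j, some k} z u ∧ κ u ≠ κ x ∧ κ u ≠ κ x'}) ?_).1
      ⟨hu, h1, h2⟩
    · exact this.1
    · rintro _ (rfl | rfl) v ⟨hv, h1, h2⟩
      · refine ⟨?_, by rwa [h.inv], by rwa [h.inv]⟩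
        rw [← jeq v (ne_of_κ h1) (ne_of_κ h2) (ne_of_κ (by rwa [hz]))
          (ne_of_κ (by rwa [h.inv]))]
        exact hv.inv (by simp)
      · refine ⟨?_, by rwa [h.inv], by rwa [h.inv]⟩
        rw [← keq v (ne_of_κ (by rwa [κy])) (ne_of_κ (by rwa [κy'])) (ne_of_κ (by rwa [hz]))
          (ne_of_κ (by rwa [h.inv, κy']))]
        exact hv.inv (by simp)
  · intro u hu h1
    by_contra h2
    exact U0 u ⟨hu, h1, h2⟩
  · intro hc
    refine hxS ?_
    have := oS _ hc
    rwa [hx', G.inv_inv] at this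

end IsCopyIndex

end Bubble

namespace Bubble

namespace IsCopyIndex

variable {C V I : Type} [Finite V] {G : Bubble (Option C) V} {κ : V → I}

/-- Let `a`, `b` be the interaction bubbles of a face of length two with vertices `x`, `y` in `a`.
Every other vertex `z` of `a` belongs to a set `P` whose only other point `z'` in `a ∪ b` lies
in `b`, such that `P` is closed under color `0` and is a union of interaction bubbles outside
`a ∪ b`: only the edges of color `0` at `z` and `z'` connect `P` to the rest of the graph. -/
theorem exists_two_point_set (h : G.IsCopyIndex κ) (hG : G.Connected) (hT : G.IsTight)
    (hC : 2 ≤ Nat.card C) {i : C} {x : V}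
    (hx : G.inv none (G.inv (some i) x) = G.inv (some i) (G.inv none x)) (z : V)
    (hz : κ z = κ x) (hzx : z ≠ x) (hzy : z ≠ G.inv (some i) x) :
    ∃ (P : Set V) (z' : V), z ∈ P ∧ z' ∈ P ∧ κ z' = κ (G.inv none x) ∧
      (∀ u ∈ P, G.inv none u ∈ P) ∧
      (∀ u ∈ P, κ u ≠ κ x → κ u ≠ κ (G.inv none x) → ∀ w, κ w = κ u → w ∈ P) ∧
      (∀ u ∈ P, κ u = κ x → u = z) ∧ (∀ u ∈ P, κ u = κ (G.inv none x) → u = z') := by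
  classical
  obtain ⟨x', hx'⟩ : ∃ x', x' = G.inv none x := ⟨_, rfl⟩
  have κx' : κ x' ≠ κ x := by rw [hx']; exact h.map_inv_none_ne hG hT hC x
  -- The class of `z` after the interaction bubbles `a` and `b` are dissolved into their vertices.
  let ρ : V → V → Prop := fun u w => G.inv none u = w ∨ (κ u ≠ κ x ∧ κ u ≠ κ x' ∧ κ w = κ u)
  let P : V → Set V := fun z => {u | Relation.EqvGen ρ z u}
  have hP0 : ∀ z, ∀ u ∈ P z, G.inv none u ∈ P z := fun z u hu =>
    Relation.EqvGen.trans _ _ _ hu (.rel _ _ (Or.inl rfl))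
  have hPκ : ∀ z, ∀ u ∈ P z, κ u ≠ κ x → κ u ≠ κ x' → ∀ w, κ w = κ u → w ∈ P z :=
    fun z u hu h1 h2 w hw => Relation.EqvGen.trans _ _ _ hu (.rel _ _ (Or.inr ⟨h1, h2, hw⟩))
  let A : Set V := {u | κ u = κ x} \ {x, G.inv (some i) x}
  let B : Set V := {u | κ u = κ x'} \ {x', G.inv (some i) x'}
  have hPS : ∀ z ∈ A, (∀ u ∈ P z, κ u = κ x → u = z) ∧ x' ∉ P z ∧ G.inv (some i) x' ∉ P z := by
    rintro z ⟨h1, h2⟩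
    simp only [Set.mem_insert_iff, Set.mem_singleton_iff, not_or] at h2
    obtain ⟨S, s1, s2, s3, s4, s5, s6⟩ := h.exists_separating_set hG hT hC hx h1 h2.1 h2.2
    rw [← hx'] at s3 s5 s6
    have sub : ∀ u w, Relation.EqvGen ρ u w → (u ∈ S ↔ w ∈ S) := by
      intro u w huw
      induction huw with
      | rel u w huw =>
        rcases huw with rfl | ⟨k1, k2, k3⟩
        · exact ⟨s2 u, fun h => by simpa [G.inv_inv] using s2 _ h⟩
        · exact ⟨fun hu => s3 u hu k1 k2 w k3,
            fun hw => s3 w hw (by rwa [k3]) (by rwa [k3]) u k3.symm⟩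
      | refl u => rfl
      | symm u w _ ih => exact ih.symm
      | trans u v w _ _ ih₁ ih₂ => exact ih₁.trans ih₂
    have hsub : P z ⊆ S := fun u hu => (sub z u hu).1 s1
    exact ⟨fun u hu => s4 u (hsub hu), fun hu => s5 (hsub hu), fun hu => s6 (hsub hu)⟩
  -- `P z` has an even number of elements, so it cannot meet `a ∪ b` in `z` only.
  have hPb : ∀ z ∈ A, ∃ z' ∈ B, z' ∈ P z := by
    intro z hz
    obtain ⟨p1, p2, p3⟩ := hPS z hz
    by_contra! hn
    have hb : ∀ u ∈ P z, κ u ≠ κ x' := fun u hu e => by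
      refine hn u ⟨e, ?_⟩ hu
      rintro (rfl | rfl)
      · exact p2 hu
      · exact p3 hu
    refine G.not_closed_of_closed G none (some i) (P z) z (.refl z) (hP0 z) fun u hu huz => ?_
    have ha : κ u ≠ κ x := fun e => huz (p1 u hu e)
    refine ⟨hPκ z u hu ha (hb u hu) _ (h.inv i u), fun e => ha ?_⟩
    rw [← h.inv i u, e]; exact hz.1
  choose! φ hφB hφP using hPb
  have hinj : Set.InjOn φ A := by
    intro z hz w hw e
    have h1 : w ∈ P z := by
      have hw' := hφP w hw
      rw [← e] at hw'
      exact Relation.EqvGen.trans _ _ _ (hφP z hz) (Relation.EqvGen.symm _ _ hw')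
    exact ((hPS z hz).1 w h1 hw.1).symm
  have hcardA : A.ncard = B.ncard := by
    have e1 : A.ncard + 2 = Nat.card C + 1 := by
      rw [← h.card (κ x), ← Set.ncard_pair (G.inv_ne (some i) x).symm]
      refine Set.ncard_sdiff_add_ncard_of_subset ?_
      rintro _ (rfl | rfl)
      · rfl
      · exact h.inv i x
    have e2 : B.ncard + 2 = Nat.card C + 1 := by
      rw [← h.card (κ x'), ← Set.ncard_pair (G.inv_ne (some i) x').symm]
      refine Set.ncard_sdiff_add_ncard_of_subset ?_
      rintro _ (rfl | rfl)
      · rfl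
      · exact h.inv i x'
    omega
  have hsurj : φ '' A = B := by
    refine Set.eq_of_subset_of_ncard_le (Set.image_subset_iff.2 hφB) ?_
    rw [hinj.ncard_image, hcardA]
  have hzA : z ∈ A := ⟨hz, by simp [hzx, hzy]⟩
  obtain ⟨p1, p2, p3⟩ := hPS z hzA
  rw [← hx']
  refine ⟨P z, φ z, .refl z, hφP z hzA, (hφB z hzA).1, hP0 z, hPκ z, p1, fun u hu hub => ?_⟩
  have huB : u ∈ B := ⟨hub, by
    rintro (rfl | rfl)
    · exact p2 hu
    · exact p3 hu⟩
  rw [← hsurj] at huB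
  obtain ⟨w, hw, rfl⟩ := huB
  have hwz : w ∈ P z := Relation.EqvGen.trans _ _ _ hu (Relation.EqvGen.symm _ _ (hφP w hw))
  rw [p1 w hwz hw.1]

end IsCopyIndex

/-! ### Cutting along two edges of color `0` -/

variable {C V : Type}

/-- The subgraph formed by a set of vertices closed under all colors. -/
def restrict (B : Bubble C V) (X : Set V) (hX : ∀ c, ∀ u ∈ X, B.inv c u ∈ X) : Bubble C X where
  inv c u := ⟨B.inv c u, hX c u u.2⟩
  inv_inv c u := Subtype.ext (B.inv_inv c u)
  inv_ne c u h := B.inv_ne c u (congrArg Subtype.val h)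

/-- If the only edges between `Q` and its complement are the edges of color `0` at `z` and `z'`, then
`G` is the insertion of a graph with set of vertices `Q` in a graph with set of vertices `Qᶜ`. -/
theorem exists_isIso_insertion (G : Bubble (Option C) V) (Q : Set V) {z z' : V} (hzz' : z ≠ z')
    (hz : z ∉ Q) (hz' : z' ∉ Q) (hw : G.inv none z ∈ Q) (hw' : G.inv none z' ∈ Q)
    (hQ : ∀ u ∈ Q, G.inv none u ∈ Q ∨ u = G.inv none z ∨ u = G.inv none z')
    (hQs : ∀ c, ∀ u ∈ Q, G.inv (some c) u ∈ Q) :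
    ∃ (G' : Bubble (Option C) V) (hX : ∀ c, ∀ u ∈ Q, G'.inv c u ∈ Q)
      (hY : ∀ c, ∀ u ∈ Qᶜ, G'.inv c u ∈ Qᶜ) (v : ↥Qᶜ) (w : ↥Q),
      (∀ c, G'.inv (some c) = G.inv (some c)) ∧
      ((G'.restrict Qᶜ hY).insertion v (G'.restrict Q hX) w).IsIso G := by
  classical
  have hzw' : G.inv none z ≠ z' := fun e => hz' (e ▸ hw)
  obtain ⟨G', s⟩ := G.exists_isSwitch none hzz' hzw'
  have hX : ∀ c, ∀ u ∈ Q, G'.inv c u ∈ Q := by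
    rintro (_ | c) u hu
    · by_cases h3 : u = G.inv none z
      · rw [h3, s.right]; exact hw'
      by_cases h4 : u = G.inv none z'
      · rw [h4, s.right']; exact hw
      rw [s.other u (fun e => hz (e ▸ hu)) (fun e => hz' (e ▸ hu)) h3 h4]
      rcases hQ u hu with h | h | h
      · exact h
      · exact absurd h h3
      · exact absurd h h4
    · rw [s.of_ne _ (by simp)]; exact hQs c u hu
  have hY : ∀ c, ∀ u ∈ Qᶜ, G'.inv c u ∈ Qᶜ := fun c u hu h =>
    hu (by simpa [G'.inv_inv] using hX c _ h)
  refine ⟨G', hX, hY, ⟨z, hz⟩, ⟨G.inv none z, hw⟩, fun c => s.of_ne _ (by simp),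
    (Equiv.sumComm _ _).trans (Equiv.Set.sumCompl Q), ?_⟩
  rintro (_ | c) (⟨u, hu⟩ | ⟨u, hu⟩)
  · by_cases h1 : u = z
    · subst h1
      simp [insertion]
    by_cases h2 : u = z'
    · subst h2
      simp [insertion, restrict, s.left, s.right, h1]
    · have h3 : u ≠ G.inv none z := fun e => hu (e ▸ hw)
      have h4 : u ≠ G.inv none z' := fun e => hu (e ▸ hw')
      simp [insertion, restrict, s.left, h1, h2, s.other u h1 h2 h3 h4]
  · by_cases h3 : u = G.inv none z
    · subst h3
      simp [insertion, G.inv_inv]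
    by_cases h4 : u = G.inv none z'
    · subst h4
      simp [insertion, restrict, s.left, s.right, G.inv_inv, h3]
    · have h1 : u ≠ z := fun e => hz (e ▸ hu)
      have h2 : u ≠ z' := fun e => hz' (e ▸ hu)
      simp [insertion, restrict, s.right, h3, h4, s.other u h1 h2 h3 h4]
  · simp [insertion, restrict, s.of_ne]
  · simp [insertion, restrict, s.of_ne]

end Bubble

section vacuum

variable {R : ℕ} [Fact R.Prime] {hR : Odd R} {V : Type}

theorem IsVacuumGraph.restrict {G G' : Bubble (Option (ZMod R)) V} (hG : IsVacuumGraph hR G)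
    (hG' : ∀ c, G'.inv (some c) = G.inv (some c)) {X : Set V}
    (hX : ∀ c, ∀ u ∈ X, G'.inv c u ∈ X) (hc : (G'.restrict X hX).Connected) :
    IsVacuumGraph hR (G'.restrict X hX) := by
  obtain ⟨-, n, e, he⟩ := hG
  have hκ := isCopyIndex_of_equiv e he
  have hcl : ∀ u ∈ X, ∀ w, (e w).1 = (e u).1 → w ∈ X := by
    intro u hu w hw
    refine ((hκ.connOn 0 1 zero_ne_one u w hw.symm).mem_iff (X := X) ?_).1 hu
    rintro _ (rfl | rfl) v hv
    · rw [← hG']; exact hX _ v hv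
    · rw [← hG']; exact hX _ v hv
  refine .of_isIso_copies (I := {m : Fin n // ∃ u ∈ X, (e u).1 = m}) hc
    ⟨⟨fun u => (⟨(e u).1, u, u.2, rfl⟩, (e u).2),
      fun p => ⟨e.symm (p.1, p.2), ?_⟩, fun u => Subtype.ext (e.symm_apply_apply u), ?_⟩, ?_⟩
  · obtain ⟨⟨m, u, hu, rfl⟩, x⟩ := p
    exact hcl u hu _ (by simp)
  · rintro ⟨⟨m, u, hu, rfl⟩, x⟩
    simp
  · intro c u
    have : e (G'.inv (some c) u) = ((e u).1, (completeBubble R hR).inv c (e u).2) := by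
      rw [hG']; exact he c u
    simp [Bubble.restrict, deleteZero, keep, copies, this]

/-- A tight graph with two interaction bubbles, all of whose edges of color `0` join these two, is
the elementary mirror melon. All its faces have exactly four vertices, so color `0` commutes with
the other colors. -/
theorem isIso_elementaryMirrorMelon {G : Bubble (Option (ZMod R)) V} (hG : IsVacuumGraph hR G)
    (hT : G.IsTight) (hR3 : 3 ≤ R) {n : ℕ} (e : V ≃ Fin n × Option (ZMod R))
    (he : ∀ c v, e (G.inv (some c) v) = ((e v).1, (completeBubble R hR).inv c (e v).2))
    {a b : Fin n} (hab : a ≠ b) (hall : ∀ u, (e u).1 = a ∨ (e u).1 = b) :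
    (completeBubble R hR).elementaryMirrorMelon.IsIso G := by
  have := hG.finite
  have hκ := isCopyIndex_of_equiv e he
  have hcon := hG.1
  have hC : 2 ≤ Nat.card (ZMod R) := by rw [Nat.card_zmod]; omega
  have hV : Nat.card V = 2 * (R + 1) := by
    have e1 : ({u | (e u).1 = a} ∪ {u | (e u).1 = b}).ncard = Nat.card V := by
      rw [← Set.ncard_univ]
      congr 1
      ext u
      simpa using hall u
    rw [Set.ncard_union_eq, hκ.card, hκ.card, Nat.card_zmod] at e1
    · omega
    · rw [Set.disjoint_left]
      intro u h1 h2
      exact hab (h1.symm.trans h2)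
  have hn : G.deleteZero.numComponents = 2 := by
    have h1 := hκ.card_eq
    rw [hV, Nat.card_zmod, mul_comm] at h1
    exact (Nat.eq_of_mul_eq_mul_left (Nat.succ_pos R) h1).symm
  have hne := fun i u => hκ.inv_none_ne_inv_some hcon hT hC i u
  have hcomm : ∀ i u, G.inv none (G.inv (some i) u) = G.inv (some i) (G.inv none u) := by
    intro i u
    classical
    have hTi := hT i
    rw [numFaces_eq, hn, Nat.card_zmod] at hTi
    have c0 : none ∈ ({none, some i} : Set (Option (ZMod R))) := by simp
    have ci : some i ∈ ({none, some i} : Set (Option (ZMod R))) := by simp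
    have n1 := hne i
    have n2 := G.inv_ne none
    have n3 := G.inv_ne (some i)
    have k2 := G.inv_inv none
    have k3 := G.inv_inv (some i)
    let X : V → Finset V := fun x =>
      {x, G.inv (some i) x, G.inv none x, G.inv none (G.inv (some i) x)}
    have hX4 : ∀ x, (X x).card = 4 := by
      intro x
      simp only [X]
      repeat rw [Finset.card_insert_of_notMem]
      · simp
      all_goals
        simp only [Finset.mem_insert, Finset.mem_singleton, not_or]
        grind
    have hXsub : ∀ x, (X x : Set V) ⊆ {u | G.ConnOn {none, some i} x u} := by
      intro x u hu
      have hx := ConnOn.refl (B := G) (S := {none, some i}) x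
      simp only [X, Finset.coe_insert, Finset.coe_singleton, Set.mem_insert_iff,
        Set.mem_singleton_iff] at hu
      rcases hu with rfl | rfl | rfl | rfl
      · exact hx
      · exact hx.inv ci
      · exact hx.inv c0
      · exact (hx.inv ci).inv c0
    have h4 := ncard_class_eq_of_mul_numClasses_eq
      (fun v w => ∃ c ∈ ({none, some i} : Set (Option (ZMod R))), G.inv c v = w) 4
      (fun x => by
        rw [← hX4 x, ← Set.ncard_coe_finset]
        exact Set.ncard_le_ncard (hXsub x))
      (by
        change 4 * G.numComps _ = _
        rw [hV]; omega) u
    have heq : (X u : Set V) = {w | G.ConnOn {none, some i} u w} :=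
      Set.eq_of_subset_of_ncard_le (hXsub u) (by
        rw [Set.ncard_coe_finset, hX4]; exact h4.le)
    have hmem : G.inv (some i) (G.inv none u) ∈ (X u : Set V) := by
      rw [heq]
      exact ((ConnOn.refl u).inv c0).inv ci
    simp only [X, Finset.coe_insert, Finset.coe_singleton, Set.mem_insert_iff,
      Set.mem_singleton_iff] at hmem
    grind
  -- Vertices of the second interaction bubble are labeled like their neighbors of color `0`.
  let ψ : Bool × Option (ZMod R) → V := fun p =>
    if p.1 then G.inv none (e.symm (a, p.2)) else e.symm (a, p.2)
  have κψ : ∀ p, (e (ψ p)).1 = a ↔ p.1 = false := by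
    rintro ⟨s, w⟩
    have := hκ.map_inv_none_ne hcon hT hC (e.symm (a, w))
    cases s
    · simp [ψ]
    · simpa [ψ] using this
  have hinj : Function.Injective ψ := by
    rintro ⟨s, w⟩ ⟨s', w'⟩ h
    have h1 := κψ (s, w)
    rw [h, κψ (s', w')] at h1
    have hs : s' = s := by revert h1; cases s <;> cases s' <;> simp
    subst hs
    cases s'
    · simpa [ψ] using h
    · have := G.inv_injective none (by simpa [ψ] using h)
      simpa using this
  have hbij : Function.Bijective ψ := hinj.bijective_of_nat_card_le (by
    rw [hV, Nat.card_prod, Finite.card_option, Nat.card_zmod, Nat.card_eq_fintype_card,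
      Fintype.card_bool])
  refine ⟨Equiv.ofBijective ψ hbij, ?_⟩
  have hsymm : ∀ c w, e.symm (a, (completeBubble R hR).inv c w) = G.inv (some c) (e.symm (a, w)) :=
    fun c w => e.injective (by rw [he]; simp)
  rintro (_ | c) ⟨s, w⟩
  · cases s <;> simp [elementaryMirrorMelon, ψ, G.inv_inv]
  · cases s <;> simp [elementaryMirrorMelon, ψ, hsymm, hcomm]

/-- By induction on the number of vertices: if some edge of color `0` at the vertices of a face of
length two leaves its two interaction bubbles, then the graph is an insertion. -/
theorem isMirrorMelon_of_isTight (hR3 : 3 ≤ R) {G : Bubble (Option (ZMod R)) V}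
    (hG : IsVacuumGraph hR G) (hT : G.IsTight) : (completeBubble R hR).IsMirrorMelon G := by
  obtain ⟨N, hN⟩ : ∃ N, Nat.card V = N := ⟨_, rfl⟩
  induction N using Nat.strong_induction_on generalizing V with
  | _ N ih =>
  have := hG.finite
  have hcon := hG.1
  obtain ⟨n, e, he⟩ := hG.2
  have hκ := isCopyIndex_of_equiv e he
  have hC : 2 ≤ Nat.card (ZMod R) := by rw [Nat.card_zmod]; omega
  obtain ⟨i, x, hx⟩ := hκ.exists_length_two hcon hT (by
    rw [Nat.card_zmod]
    obtain ⟨k, hk⟩ := hR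
    omega)
  have hab := hκ.map_inv_none_ne hcon hT hC x
  by_cases hout : ∀ z, (e z).1 = (e x).1 → (e (G.inv none z)).1 = (e (G.inv none x)).1
  · -- All the edges of color `0` at the first interaction bubble lead to the second one.
    refine .iso _ _ .elementary
      (isIso_elementaryMirrorMelon hG hT hR3 e he hab.symm fun u => ?_)
    have hin : ∀ u, (e u).1 = (e (G.inv none x)).1 → (e (G.inv none u)).1 = (e x).1 := by
      have himg : G.inv none '' {u | (e u).1 = (e x).1} = {u | (e u).1 = (e (G.inv none x)).1} := by
        refine Set.eq_of_subset_of_ncard_le (Set.image_subset_iff.2 hout) ?_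
        rw [Set.ncard_image_of_injective _ (G.inv_injective none), hκ.card, hκ.card]
      intro u hu
      have : u ∈ G.inv none '' {u | (e u).1 = (e x).1} := himg ▸ hu
      obtain ⟨w, hw, rfl⟩ := this
      rw [G.inv_inv]; exact hw
    have h01 : (0 : ZMod R) ≠ 1 := zero_ne_one
    refine ((hκ.connOn_of_connected hcon h01 x u).mem_iff
      (X := {u | (e u).1 = (e x).1 ∨ (e u).1 = (e (G.inv none x)).1}) ?_).1 (Or.inl rfl)
    rintro (_ | c) - u hu
    · rcases hu with hu | hu
      · exact Or.inr (hout u hu)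
      · exact Or.inl (hin u hu)
    · change (e _).1 = _ ∨ (e _).1 = _
      rw [hκ.inv c u]; exact hu
  · push Not at hout
    obtain ⟨z, hza, hzb⟩ := hout
    have hzx : z ≠ x := by rintro rfl; exact hzb rfl
    have hzy : z ≠ G.inv (some i) x := by
      rintro rfl
      rw [hx] at hzb
      exact hzb (hκ.inv i _)
    obtain ⟨P, z', p1, p2, p3, p4, p5, p6, p7⟩ :=
      hκ.exists_two_point_set hcon hT hC hx z hza hzx hzy
    have hza' : (e (G.inv none z)).1 ≠ (e x).1 := by
      rw [← hza]; exact hκ.map_inv_none_ne hcon hT hC z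
    have hzz' : z ≠ z' := by rintro rfl; exact hab (p3.symm.trans hza)
    let Q : Set V := {u | u ∈ P ∧ (e u).1 ≠ (e x).1 ∧ (e u).1 ≠ (e (G.inv none x)).1}
    have hzQ : z ∉ Q := fun h => h.2.1 hza
    have hz'Q : z' ∉ Q := fun h => h.2.2 p3
    have hwQ : G.inv none z ∈ Q := ⟨p4 z p1, hza', hzb⟩
    have hw'Q : G.inv none z' ∈ Q := by
      refine ⟨p4 z' p2, fun e1 => ?_, fun e2 => ?_⟩
      · have := p6 _ (p4 z' p2) e1
        exact hz'Q (by rw [inv_eq_iff] at this; rw [this]; exact hwQ)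
      · rw [← p3] at e2
        exact hκ.map_inv_none_ne hcon hT hC z' e2
    obtain ⟨G', hX, hY, v, w, hG', hiso⟩ := G.exists_isIso_insertion Q hzz' hzQ hz'Q hwQ hw'Q
      (fun u hu => by
        by_cases h1 : (e (G.inv none u)).1 = (e x).1
        · exact Or.inr (Or.inl (by rw [← inv_eq_iff]; exact p6 _ (p4 u hu.1) h1))
        by_cases h2 : (e (G.inv none u)).1 = (e (G.inv none x)).1
        · exact Or.inr (Or.inr (by rw [← inv_eq_iff]; exact p7 _ (p4 u hu.1) h2))
        exact Or.inl ⟨p4 u hu.1, h1, h2⟩)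
      (fun c u hu => ⟨p5 u hu.1 hu.2.1 hu.2.2 _ (hκ.inv c u), by rw [hκ.inv]; exact hu.2.1,
        by rw [hκ.inv]; exact hu.2.2⟩)
    obtain ⟨c1, c2⟩ := (connected_insertion_iff _ v _ w).1 (hiso.symm.connected hcon)
    have v1 := hG.restrict hG' hY c1
    have v2 := hG.restrict hG' hX c2
    -- The excesses of the two graphs add up to zero, and have nonpositive sums of pairs.
    have hsum : ∀ k, (G'.restrict Qᶜ hY).faceExcess k + (G'.restrict Q hX).faceExcess k = 0 := by
      intro k
      rw [← faceExcess_insertion _ v _ w, ← hiso.faceExcess_eq]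
      exact G.isTight_iff.1 hT k
    obtain ⟨_, κ₁, hκ₁⟩ := v1.exists_isCopyIndex
    obtain ⟨_, κ₂, hκ₂⟩ := v2.exists_isCopyIndex
    have t1 : ∀ k, (G'.restrict Qᶜ hY).faceExcess k = 0 :=
      eq_zero_of_pairs (by rw [ZMod.card]; exact hR3) fun k l hkl => by
        have b1 := hκ₁.faceExcess_add_le c1 hkl
        have b2 := hκ₂.faceExcess_add_le c2 hkl
        linarith [hsum k, hsum l]
    have t2 : ∀ k, (G'.restrict Q hX).faceExcess k = 0 := fun k => by
      have := hsum k
      rwa [t1, zero_add] at this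
    have l1 : Nat.card ↥Qᶜ < N := by
      rw [← hN, Nat.card_coe_set_eq, ← Set.ncard_univ]
      exact Set.ncard_lt_ncard ((Set.ssubset_univ_iff).2 fun e => (e ▸ Set.mem_univ _ :
        G.inv none z ∈ Qᶜ) hwQ)
    have l2 : Nat.card ↥Q < N := by
      rw [← hN, Nat.card_coe_set_eq, ← Set.ncard_univ]
      exact Set.ncard_lt_ncard ((Set.ssubset_univ_iff).2 fun e => hzQ (e ▸ Set.mem_univ _))
    exact .iso _ _ (IsMirrorMelon.insertion_of_isMirrorMelon
      (ih _ l2 v2 ((isTight_iff _).2 t2) rfl) (ih _ l1 v1 ((isTight_iff _).2 t1) rfl) v w) hiso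

end vacuum

theorem theorem1 (R : ℕ) [Fact R.Prime] (hR : Odd R) (V : Type)
    (G : Bubble (Option (ZMod R)) V) :
    List.TFAE
      [ IsLeadingOrder hR G,
        IsGeneralizedMelon hR G,
        IsVacuumGraph hR G ∧
          ∀ i j : ZMod R, i ≠ j → G.PlanarAt none (some i) (some j),
        (completeBubble R hR).IsMirrorMelon G ] := by
  have hR3 : 3 ≤ R := by
    have := (Fact.out : R.Prime).two_le
    obtain ⟨k, hk⟩ := hR
    omega
  have hcard : 3 ≤ Fintype.card (ZMod R) := by rw [ZMod.card]; exact hR3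
  -- The pairs of colors have nonpositive excess, and the total excess is nonpositive.
  have pairs : ∀ {V : Type} {G : Bubble (Option (ZMod R)) V}, IsVacuumGraph hR G →
      ∀ i j, i ≠ j → G.faceExcess i + G.faceExcess j ≤ 0 := fun h i j hij => by
    obtain ⟨_, κ, hκ⟩ := h.exists_isCopyIndex
    have := h.finite
    exact hκ.faceExcess_add_le h.1 hij
  have total : ∀ {V : Type} {G : Bubble (Option (ZMod R)) V}, IsVacuumGraph hR G →
      ∑ i, G.faceExcess i ≤ 0 := fun h => sum_nonpos_of_pairs (by omega) (pairs h)
  tfae_have 1 → 2 := by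
    rintro ⟨h, hmax⟩
    have h1 := hmax _ _ isVacuumGraph_elementaryMirrorMelon
    rw [powerOfN_eq h, powerOfN_eq isVacuumGraph_elementaryMirrorMelon] at h1
    simp only [faceExcess_elementaryMirrorMelon, Finset.sum_const_zero] at h1
    have h2 : ∑ i, G.faceExcess i = 0 := by linarith [total h]
    obtain ⟨_, κ, hκ⟩ := h.exists_isCopyIndex
    have := h.finite
    exact ⟨h, by rw [hκ.index_eq h.1, h2, mul_zero]⟩
  tfae_have 2 → 3 := by
    rintro ⟨h, hind⟩
    refine ⟨h, fun i j hij => ?_⟩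
    obtain ⟨_, κ, hκ⟩ := h.exists_isCopyIndex
    have := h.finite
    rw [hκ.index_eq h.1, ZMod.card] at hind
    have hR3' : (3 : ℚ) ≤ R := by exact_mod_cast hR3
    have h2 : ∑ i, G.faceExcess i = 0 := by
      rcases mul_eq_zero.1 hind with h0 | h0
      · linarith
      · exact h0
    exact (hκ.planarAt_iff h.1 hij).2 (pairs_eq_zero_of_sum (pairs h) h2 i j hij)
  tfae_have 3 → 4 := by
    rintro ⟨h, hpl⟩
    obtain ⟨_, κ, hκ⟩ := h.exists_isCopyIndex
    have := h.finite
    refine isMirrorMelon_of_isTight hR3 h (G.isTight_iff.2 ?_)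
    exact eq_zero_of_pairs hcard fun i j hij => (hκ.planarAt_iff h.1 hij).1 (hpl i j hij)
  tfae_have 4 → 1 := by
    intro h
    obtain ⟨h1, h2⟩ := h.isVacuumGraph_and_faceExcess
    refine ⟨h1, fun V' G' h' => ?_⟩
    rw [powerOfN_eq h1, powerOfN_eq h']
    simp only [h2, Finset.sum_const_zero]
    linarith [total h']
  tfae_finish
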